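/- Let $M$ be a smooth 4-manifold with boundary $\mathcal H=\partial M$, and let $\tilde g$ be a smooth Lorentzian metric of signature $(+,-,-,-)$ with $\mathrm{Ric}(\tilde g)=0$ on $\tilde M = M\setminus\mathcal H$. Suppose that $(\tilde M,\tilde g)$ is asymptotically Minkowskian at spatial infinity (AMSI) with asymptote $\mathcal H$, that is, there is a smooth function $\Omega$ on $M$, non-vanishing on $\tilde M$, such that (i) $\Omega=0$ and $d\Omega\neq 0$ on $\mathcal H$; (ii) the tensor field $q=\Omega^2(\tilde g+\Omega^{-4}\,d\Omega\otimes d\Omega)$ and the vector field $N=\Omega^{-4}\,\tilde g^\sharp(d\Omega,\cdot)$ on $\tilde M$ extend smoothly to $M$, and the pullback of $q$ to $\mathcal H$ has signature $(+,-,-)$; (iii) $\mathcal H$ is homeomorphic to $\mathbb R\times\mathbb S^2$; (iv) $\mathcal H$ is geodesically complete with respect to the pullback of $q$. Let $g=\Omega^2\tilde g$ on $\tilde M$. Then near each point of $\mathcal H$ one has $g^\sharp(d\Omega,d\Omega)<0$ on $\tilde M$, so that the hypersurfaces of constant $\Omega$ have the unit normal $n^a=g^{ab}\nabla_b\Omega/\sqrt{|g^{cd}\nabla_c\Omega\nabla_d\Omega|}$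 there, and the electric and magnetic parts of the Weyl tensor $C_{abcd}$ of $g$, $$E_{ab}=C_{acbd}\,n^c n^d,\qquad B_{ab}={}^*C_{acbd}\,n^c n^d,\qquad {}^*C_{acbd}=\tfrac12\,\epsilon_{ac}{}^{ef}C_{efbd},$$ where $\epsilon$ is the volume form of $g$ (the choice of orientation affects only the sign of $B_{ab}$), tend to zero on $\mathcal H$: for every point $p\in\mathcal H$ and every smooth chart of $M$ around $p$, all components $E_{ab}$ and $B_{ab}$ in that chart tend to $0$ as the point $x\in\tilde M$ tends to $p$. -/

import Mathlib

open scoped Manifold ContDiff Topology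

noncomputable section

namespace SpatialInfinity

/-! Local pseudo-Riemannian geometry: a metric is given by its component matrix `G`, a function of
the coordinates `y ∈ ℝⁿ`. -/

/-- The partial derivative `∂ₖ f` at the point `y` of `ℝⁿ`. -/
def partialD {n : ℕ} (k : Fin n) (f : EuclideanSpace ℝ (Fin n) → ℝ)
    (y : EuclideanSpace ℝ (Fin n)) : ℝ :=
  fderiv ℝ f y (EuclideanSpace.single k 1)

/-- `christoffel G y k i j` is the Christoffel symbol `Γᵏᵢⱼ` of `G` at `y`. -/
def christoffel {n : ℕ} (G : EuclideanSpace ℝ (Fin n) → Matrix (Fin n) (Fin n) ℝ)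
    (y : EuclideanSpace ℝ (Fin n)) (k i j : Fin n) : ℝ :=
  (1 / 2) * ∑ l, (G y)⁻¹ k l *
    (partialD i (fun z => G z l j) y + partialD j (fun z => G z l i) y
      - partialD l (fun z => G z i j) y)

/-- `riemann G y c d a b` is the component `Rᶜ_{dab}` of the curvature tensor, with the convention
`(∇ₐ∇_b - ∇_b∇ₐ) vᶜ = Rᶜ_{dab} vᵈ`. -/
def riemann {n : ℕ} (G : EuclideanSpace ℝ (Fin n) → Matrix (Fin n) (Fin n) ℝ)
    (y : EuclideanSpace ℝ (Fin n)) (c d a b : Fin n) : ℝ :=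
  partialD a (fun z => christoffel G z c b d) y - partialD b (fun z => christoffel G z c a d) y
    + ∑ e, (christoffel G y c a e * christoffel G y e b d
      - christoffel G y c b e * christoffel G y e a d)

/-- The Ricci tensor `R_{db} = Rᶜ_{dcb}`. -/
def ricci {n : ℕ} (G : EuclideanSpace ℝ (Fin n) → Matrix (Fin n) (Fin n) ℝ)
    (y : EuclideanSpace ℝ (Fin n)) (d b : Fin n) : ℝ :=
  ∑ c, riemann G y c d c b

/-- The Ricci scalar. -/
def ricciScalar {n : ℕ} (G : EuclideanSpace ℝ (Fin n) → Matrix (Fin n) (Fin n) ℝ)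
    (y : EuclideanSpace ℝ (Fin n)) : ℝ :=
  ∑ a, ∑ b, (G y)⁻¹ a b * ricci G y a b

/-- The Schouten tensor `L_{ab} = (R_{ab} - R g_{ab} / 6) / 2` of a four-dimensional metric. -/
def schouten (G : EuclideanSpace ℝ (Fin 4) → Matrix (Fin 4) (Fin 4) ℝ)
    (y : EuclideanSpace ℝ (Fin 4)) (a b : Fin 4) : ℝ :=
  (1 / 2) * (ricci G y a b - (1 / 6) * ricciScalar G y * G y a b)

/-- `weyl G y c d a b` is the component `C_{cdab}` of the Weyl tensor, all indices lowered with the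
metric: `R_{cdab} = C_{cdab} + g_{ca} L_{bd} - g_{cb} L_{ad} - g_{da} L_{bc} + g_{db} L_{ac}`. -/
def weyl (G : EuclideanSpace ℝ (Fin 4) → Matrix (Fin 4) (Fin 4) ℝ)
    (y : EuclideanSpace ℝ (Fin 4)) (c d a b : Fin 4) : ℝ :=
  (∑ e, G y c e * riemann G y e d a b)
    - (G y c a * schouten G y b d - G y c b * schouten G y a d
      - G y d a * schouten G y b c + G y d b * schouten G y a c)

/-- Components `ε_{abcd}` of the metric volume form of the matrix `A`, for the orientation given by
the coordinates: `√|det A|` times the permutation symbol. -/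
def volumeForm (A : Matrix (Fin 4) (Fin 4) ℝ) (a b c d : Fin 4) : ℝ :=
  Real.sqrt |A.det| * ((1 : Matrix (Fin 4) (Fin 4) ℝ).submatrix ![a, b, c, d] id).det

/-- The left Hodge dual `*C_{acbd} = (1/2) ε_{ac}{}^{ef} C_{efbd}` of the Weyl tensor. -/
def weylDual (G : EuclideanSpace ℝ (Fin 4) → Matrix (Fin 4) (Fin 4) ℝ)
    (y : EuclideanSpace ℝ (Fin 4)) (a c b d : Fin 4) : ℝ :=
  (1 / 2) * ∑ p, ∑ r, ∑ e, ∑ f,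
    volumeForm (G y) a c p r * (G y)⁻¹ p e * (G y)⁻¹ r f * weyl G y e f b d

/-- The squared norm `g^{ab} α_a α_b` of the covector `α`. -/
def covectorSq (A : Matrix (Fin 4) (Fin 4) ℝ) (α : Fin 4 → ℝ) : ℝ :=
  ∑ a, ∑ b, A⁻¹ a b * α a * α b

/-- The unit normal `nᵃ = g^{ab} α_b / √|g^{cd} α_c α_d|` with conormal `α`. -/
def unitNormal (A : Matrix (Fin 4) (Fin 4) ℝ) (α : Fin 4 → ℝ) (a : Fin 4) : ℝ :=
  (∑ b, A⁻¹ a b * α b) / Real.sqrt |covectorSq A α|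

/-- The electric part `E_{ab} = C_{acbd} nᶜ nᵈ` of the Weyl tensor of `G` with respect to the unit
normal to the level sets of `w`. -/
def electricPart (G : EuclideanSpace ℝ (Fin 4) → Matrix (Fin 4) (Fin 4) ℝ)
    (w : EuclideanSpace ℝ (Fin 4) → ℝ) (y : EuclideanSpace ℝ (Fin 4)) (a b : Fin 4) : ℝ :=
  ∑ c, ∑ d, weyl G y a c b d * unitNormal (G y) (fun k => partialD k w y) c
    * unitNormal (G y) (fun k => partialD k w y) d

/-- The magnetic part `B_{ab} = *C_{acbd} nᶜ nᵈ` of the Weyl tensor of `G` with respect to the unit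
normal to the level sets of `w`. -/
def magneticPart (G : EuclideanSpace ℝ (Fin 4) → Matrix (Fin 4) (Fin 4) ℝ)
    (w : EuclideanSpace ℝ (Fin 4) → ℝ) (y : EuclideanSpace ℝ (Fin 4)) (a b : Fin 4) : ℝ :=
  ∑ c, ∑ d, weylDual G y a c b d * unitNormal (G y) (fun k => partialD k w y) c
    * unitNormal (G y) (fun k => partialD k w y) d

/-- A matrix of a symmetric bilinear form of signature `(+,-,…,-)`. -/
def HasLorentzSignature {n : ℕ} (A : Matrix (Fin (n + 1)) (Fin (n + 1)) ℝ) : Prop :=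
  ∃ P : Matrix (Fin (n + 1)) (Fin (n + 1)) ℝ, IsUnit P.det ∧
    P.transpose * A * P = Matrix.diagonal (Fin.cons 1 (fun _ => -1))

/-! Four-manifolds with boundary and the coordinate components of tensor fields on them. -/

/-- The coordinate vector `∂ᵢ` of the chart `e`, at the point with coordinates `y`. -/
def coordVec {M : Type*} [TopologicalSpace M] [ChartedSpace (EuclideanHalfSpace 4) M]
    (e : OpenPartialHomeomorph M (EuclideanHalfSpace 4)) (y : EuclideanSpace ℝ (Fin 4))
    (i : Fin 4) : TangentSpace (𝓡∂ 4) ((e.extend (𝓡∂ 4)).symm y) :=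
  mfderivWithin 𝓘(ℝ, EuclideanSpace ℝ (Fin 4)) (𝓡∂ 4) (e.extend (𝓡∂ 4)).symm
    (Set.range (𝓡∂ 4)) y (EuclideanSpace.single i (1 : ℝ) : EuclideanSpace ℝ (Fin 4))

/-- The components of a covariant 2-tensor field in the chart `e`. -/
def components {M : Type*} [TopologicalSpace M] [ChartedSpace (EuclideanHalfSpace 4) M]
    (e : OpenPartialHomeomorph M (EuclideanHalfSpace 4))
    (g : ∀ x : M, LinearMap.BilinForm ℝ (TangentSpace (𝓡∂ 4) x))
    (y : EuclideanSpace ℝ (Fin 4)) : Matrix (Fin 4) (Fin 4) ℝ :=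
  Matrix.of fun i j => g ((e.extend (𝓡∂ 4)).symm y) (coordVec e y i) (coordVec e y j)

/-- The coordinate expression of a vector field in the chart `e`. -/
def vectorComponents {M : Type*} [TopologicalSpace M] [ChartedSpace (EuclideanHalfSpace 4) M]
    (e : OpenPartialHomeomorph M (EuclideanHalfSpace 4))
    (N : ∀ x : M, TangentSpace (𝓡∂ 4) x)
    (y : EuclideanSpace ℝ (Fin 4)) : EuclideanSpace ℝ (Fin 4) :=
  mfderiv (𝓡∂ 4) 𝓘(ℝ, EuclideanSpace ℝ (Fin 4)) (e.extend (𝓡∂ 4))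
    ((e.extend (𝓡∂ 4)).symm y) (N ((e.extend (𝓡∂ 4)).symm y))

/-- The conformal metric `Ω² g`. -/
def conformalMetric {M : Type*} [TopologicalSpace M] [ChartedSpace (EuclideanHalfSpace 4) M]
    (Ω : M → ℝ) (g : ∀ x : M, LinearMap.BilinForm ℝ (TangentSpace (𝓡∂ 4) x)) :
    ∀ x : M, LinearMap.BilinForm ℝ (TangentSpace (𝓡∂ 4) x) :=
  fun x => Ω x ^ 2 • g x

/-- The differential `dΩ` at `x`. -/
def differential {M : Type*} [TopologicalSpace M] [ChartedSpace (EuclideanHalfSpace 4) M]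
    (Ω : M → ℝ) (x : M) (v : TangentSpace (𝓡∂ 4) x) : ℝ :=
  (mfderiv (𝓡∂ 4) 𝓘(ℝ, ℝ) Ω x : TangentSpace (𝓡∂ 4) x →L[ℝ] ℝ) v

/-- `g` restricts to a smooth metric of signature `(+,-,-,-)` with vanishing Ricci tensor on the
interior of `M`; its values on the boundary are irrelevant. -/
structure IsVacuumSpacetime (M : Type*) [TopologicalSpace M]
    [ChartedSpace (EuclideanHalfSpace 4) M]
    (g : ∀ x : M, LinearMap.BilinForm ℝ (TangentSpace (𝓡∂ 4) x)) : Prop where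
  smooth : ∀ e ∈ IsManifold.maximalAtlas (𝓡∂ 4) ∞ M, ∀ i j,
    ContDiffOn ℝ ∞ (fun y => components e g y i j)
      ((e.extend (𝓡∂ 4)).target ∩ (e.extend (𝓡∂ 4)).symm ⁻¹' (𝓡∂ 4).interior M)
  lorentzian : ∀ e ∈ IsManifold.maximalAtlas (𝓡∂ 4) ∞ M,
    ∀ x ∈ e.source ∩ (𝓡∂ 4).interior M,
      HasLorentzSignature (components e g (e.extend (𝓡∂ 4) x))
  ricci_flat : ∀ e ∈ IsManifold.maximalAtlas (𝓡∂ 4) ∞ M,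
    ∀ x ∈ e.source ∩ (𝓡∂ 4).interior M, ∀ a b,
      ricci (components e g) (e.extend (𝓡∂ 4) x) a b = 0

/-! Geometry of the boundary. Each chart `e` of `M` restricts to a chart of the boundary, with
coordinates `(y₁, y₂, y₃)` on the slice `y₀ = 0`. -/

/-- The point `(0, z)` of the boundary slice of the half-space. -/
def slicePoint (z : EuclideanSpace ℝ (Fin 3)) : EuclideanSpace ℝ (Fin 4) :=
  WithLp.toLp 2 (Fin.cons 0 z : Fin 4 → ℝ)

/-- The boundary coordinates `(y₁, y₂, y₃)` of a point in the chart `e`. -/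
def bdryCoord {M : Type*} [TopologicalSpace M] [ChartedSpace (EuclideanHalfSpace 4) M]
    (e : OpenPartialHomeomorph M (EuclideanHalfSpace 4)) (x : M) : EuclideanSpace ℝ (Fin 3) :=
  WithLp.toLp 2 fun i : Fin 3 => e.extend (𝓡∂ 4) x i.succ

/-- The components of the pullback of `q` to the boundary, as functions of the boundary
coordinates. -/
def bdryMetric {M : Type*} [TopologicalSpace M] [ChartedSpace (EuclideanHalfSpace 4) M]
    (e : OpenPartialHomeomorph M (EuclideanHalfSpace 4))
    (q : ∀ x : M, LinearMap.BilinForm ℝ (TangentSpace (𝓡∂ 4) x))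
    (z : EuclideanSpace ℝ (Fin 3)) : Matrix (Fin 3) (Fin 3) ℝ :=
  (components e q (slicePoint z)).submatrix Fin.succ Fin.succ

/-- `γ : ℝ → M` is an affinely parametrised geodesic of the boundary with its metric induced by
`q`. -/
structure IsBoundaryGeodesic {M : Type*} [TopologicalSpace M]
    [ChartedSpace (EuclideanHalfSpace 4) M]
    (q : ∀ x : M, LinearMap.BilinForm ℝ (TangentSpace (𝓡∂ 4) x)) (γ : ℝ → M) : Prop where
  mem_boundary : ∀ t, γ t ∈ (𝓡∂ 4).boundary M
  continuous : Continuous γ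
  contDiffAt : ∀ e ∈ IsManifold.maximalAtlas (𝓡∂ 4) ∞ M, ∀ t, γ t ∈ e.source →
    ContDiffAt ℝ 2 (fun s => bdryCoord e (γ s)) t
  geodesic_eq : ∀ e ∈ IsManifold.maximalAtlas (𝓡∂ 4) ∞ M, ∀ t, γ t ∈ e.source → ∀ k,
    iteratedDeriv 2 (fun s => bdryCoord e (γ s) k) t
      + ∑ i, ∑ j, christoffel (bdryMetric e q) (bdryCoord e (γ t)) k i j
        * deriv (fun s => bdryCoord e (γ s) i) t * deriv (fun s => bdryCoord e (γ s) j) t = 0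

/-- The boundary is geodesically complete with respect to the metric induced by `q`: through every
boundary point, with every initial velocity tangent to the boundary, there is a geodesic defined
on all of `ℝ`. -/
def BoundaryGeodesicallyComplete {M : Type*} [TopologicalSpace M]
    [ChartedSpace (EuclideanHalfSpace 4) M]
    (q : ∀ x : M, LinearMap.BilinForm ℝ (TangentSpace (𝓡∂ 4) x)) : Prop :=
  ∀ p ∈ (𝓡∂ 4).boundary M, ∀ e ∈ IsManifold.maximalAtlas (𝓡∂ 4) ∞ M, p ∈ e.source →
    ∀ v : EuclideanSpace ℝ (Fin 3), ∃ γ : ℝ → M, IsBoundaryGeodesic q γ ∧ γ 0 = p ∧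
      deriv (fun s => bdryCoord e (γ s)) 0 = v

/-- The vacuum spacetime (interior of `M`, metric `g`) possesses the boundary `H = ∂M` as an
asymptote at spatial infinity, with function `Ω`; `q` and `N` are the smooth extensions to `M` of
`Ω² (g + Ω⁻⁴ dΩ ⊗ dΩ)` and `Ω⁻⁴ g♯(dΩ, ·)`. -/
structure HasAsymptote (M : Type*) [TopologicalSpace M] [ChartedSpace (EuclideanHalfSpace 4) M]
    (g : ∀ x : M, LinearMap.BilinForm ℝ (TangentSpace (𝓡∂ 4) x)) (Ω : M → ℝ)
    (q : ∀ x : M, LinearMap.BilinForm ℝ (TangentSpace (𝓡∂ 4) x))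
    (N : ∀ x : M, TangentSpace (𝓡∂ 4) x) : Prop where
  vacuum : IsVacuumSpacetime M g
  smooth_factor : ContMDiff (𝓡∂ 4) 𝓘(ℝ, ℝ) ∞ Ω
  factor_ne_zero : ∀ x ∈ (𝓡∂ 4).interior M, Ω x ≠ 0
  factor_eq_zero : ∀ x ∈ (𝓡∂ 4).boundary M, Ω x = 0
  differential_ne_zero : ∀ x ∈ (𝓡∂ 4).boundary M,
    ∃ v : TangentSpace (𝓡∂ 4) x, differential Ω x v ≠ 0
  q_eq : ∀ x ∈ (𝓡∂ 4).interior M, ∀ v w : TangentSpace (𝓡∂ 4) x,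
    q x v w = Ω x ^ 2 * (g x v w + (Ω x ^ 4)⁻¹ * (differential Ω x v * differential Ω x w))
  q_smooth : ∀ e ∈ IsManifold.maximalAtlas (𝓡∂ 4) ∞ M, ∀ i j,
    ContDiffOn ℝ ∞ (fun y => components e q y i j) (e.extend (𝓡∂ 4)).target
  q_signature : ∀ e ∈ IsManifold.maximalAtlas (𝓡∂ 4) ∞ M,
    ∀ x ∈ e.source ∩ (𝓡∂ 4).boundary M, HasLorentzSignature (bdryMetric e q (bdryCoord e x))
  N_eq : ∀ x ∈ (𝓡∂ 4).interior M, ∀ v : TangentSpace (𝓡∂ 4) x,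
    g x (N x) v = (Ω x ^ 4)⁻¹ * differential Ω x v
  N_smooth : ∀ e ∈ IsManifold.maximalAtlas (𝓡∂ 4) ∞ M,
    ContDiffOn ℝ ∞ (vectorComponents e N) (e.extend (𝓡∂ 4)).target

/-- The spacetime (interior of `M`, metric `g`) is asymptotically Minkowskian at spatial infinity,
with asymptote `H = ∂M`: it has an asymptote, `H` is homeomorphic to `ℝ × S²`, and `H` is
geodesically complete with respect to the pullback of `q`. -/
structure IsAMSI (M : Type*) [TopologicalSpace M] [ChartedSpace (EuclideanHalfSpace 4) M]
    (g : ∀ x : M, LinearMap.BilinForm ℝ (TangentSpace (𝓡∂ 4) x)) (Ω : M → ℝ)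
    (q : ∀ x : M, LinearMap.BilinForm ℝ (TangentSpace (𝓡∂ 4) x))
    (N : ∀ x : M, TangentSpace (𝓡∂ 4) x) : Prop extends HasAsymptote M g Ω q N where
  topology : Nonempty
    ((𝓡∂ 4).boundary M ≃ₜ ℝ × Metric.sphere (0 : EuclideanSpace ℝ (Fin 3)) 1)
  complete : BoundaryGeodesicallyComplete q

end SpatialInfinity

end

/-! In a chart write w for Ω, Q for the components of q, G = Q - w⁻² dw ⊗ dw for those of Ω² g̃, and
H = G⁻¹. In terms of log |w| this is an infinitely long cylinder, so G and its curvature have poles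
at w = 0. Everything is expanded in powers of w with coefficients that extend smoothly to the
boundary point; E and B turn out to start at order w.

The gain comes from the smoothness of N = w⁻² H(dw, ·): contracting a factor dw with H produces w²
N. Moreover G N = w⁻² dw gives Q N = σ dw and dw · N = -1 + w² σ with σ smooth. The Levi-Civita
connection of G is therefore a smooth connection K plus w⁻¹ N dw ⊗ dw, so that w R is smooth, dw · R
= O(w), and raising the second index of R gives something smooth (`exists_riemann_bounds`).

The vacuum equation enters through g̃ = w⁻² G. Up to the projective change by -dw/w, the connection
of g̃ is K + w N ⊗ Q, which has no pole; the projective transformation law of the Ricci tensor then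
yields Ric(G) = -2 Q + w⁻¹ θ dw ⊗ dw + O(w) (`exists_ricci`) and the Schouten tensor
(`exists_schouten`). To leading order these are the tensors of a line times unit de Sitter 3-space,
which is conformally flat.

Since n = |w| N / √(1 - w² σ), the electric part is w² C(N, N) / (1 - w² σ). Its Riemann part is
O(w) by the bounds above, and the leading Schouten terms cancel algebraically (`exists_electric`).
For the magnetic part, the Weyl tensor with its first pair of indices raised is smooth
(`exists_raised_weyl`), the volume form is O(1/|w|) because w² det G is smooth, and n ⊗ n supplies
w².

The smoothness of H and σ is not assumed. It follows from dw ≠ 0 and the nondegeneracy of the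
pullback of q, by inverting a rank one perturbation (`exists_asymptoteData`). -/

noncomputable section

namespace SpatialInfinity

open Filter Set

/-! Functions on the interior of `R` that extend smoothly to the point `y₀` of `R`. -/

/-- Near `y₀`, the function `f` on the interior of `R` is the restriction of a function which is
smooth at `y₀` within `R`. -/
@[fun_prop]
def ExtendsSmoothly {n : ℕ} (R : Set (EuclideanSpace ℝ (Fin n))) (y₀ : EuclideanSpace ℝ (Fin n))
    (f : EuclideanSpace ℝ (Fin n) → ℝ) : Prop :=
  ∃ F : EuclideanSpace ℝ (Fin n) → ℝ, ContDiffWithinAt ℝ ∞ F R y₀ ∧ f =ᶠ[𝓝[interior R] y₀] F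

section Calculus

variable {n : ℕ} {R : Set (EuclideanSpace ℝ (Fin n))} {y₀ : EuclideanSpace ℝ (Fin n)}
  {f g : EuclideanSpace ℝ (Fin n) → ℝ}

/-- The interior is open, so an identity valid on it near `y₀` holds on a full neighbourhood of each
such point and may be differentiated there. -/
theorem eventually_eventually_nhds_of_interior {P : EuclideanSpace ℝ (Fin n) → Prop}
    (h : ∀ᶠ y in 𝓝[interior R] y₀, P y) : ∀ᶠ y in 𝓝[interior R] y₀, ∀ᶠ z in 𝓝 y, P z := by
  filter_upwards [eventually_eventually_nhdsWithin.2 h, self_mem_nhdsWithin] with y hy hyR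
  rwa [isOpen_interior.nhdsWithin_eq hyR] at hy

theorem partialD_congr {k : Fin n} {y : EuclideanSpace ℝ (Fin n)} (h : f =ᶠ[𝓝 y] g) :
    partialD k f y = partialD k g y := by
  rw [partialD, partialD, h.fderiv_eq]

theorem partialD_add {k : Fin n} {y : EuclideanSpace ℝ (Fin n)} (hf : DifferentiableAt ℝ f y)
    (hg : DifferentiableAt ℝ g y) :
    partialD k (fun z => f z + g z) y = partialD k f y + partialD k g y := by
  simp only [partialD]; rw [fderiv_fun_add hf hg]; rfl

theorem partialD_sub {k : Fin n} {y : EuclideanSpace ℝ (Fin n)} (hf : DifferentiableAt ℝ f y)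
    (hg : DifferentiableAt ℝ g y) :
    partialD k (fun z => f z - g z) y = partialD k f y - partialD k g y := by
  simp only [partialD]; rw [fderiv_fun_sub hf hg]; rfl

theorem partialD_mul {k : Fin n} {y : EuclideanSpace ℝ (Fin n)} (hf : DifferentiableAt ℝ f y)
    (hg : DifferentiableAt ℝ g y) :
    partialD k (fun z => f z * g z) y = partialD k f y * g y + f y * partialD k g y := by
  simp only [partialD]; rw [fderiv_fun_mul hf hg]; simp; ring

theorem partialD_sum {ι : Type*} {s : Finset ι} {k : Fin n} {y : EuclideanSpace ℝ (Fin n)}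
    {F : ι → EuclideanSpace ℝ (Fin n) → ℝ} (hF : ∀ i ∈ s, DifferentiableAt ℝ (F i) y) :
    partialD k (fun z => ∑ i ∈ s, F i z) y = ∑ i ∈ s, partialD k (F i) y := by
  simp only [partialD]; rw [fderiv_fun_sum hF]; simp

theorem partialD_const {k : Fin n} {y : EuclideanSpace ℝ (Fin n)} (c : ℝ) :
    partialD k (fun _ => c) y = 0 := by
  simp [partialD]

theorem partialD_inv {k : Fin n} {y : EuclideanSpace ℝ (Fin n)} (hf : DifferentiableAt ℝ f y)
    (h0 : f y ≠ 0) : partialD k (fun z => (f z)⁻¹) y = -(f y)⁻¹ ^ 2 * partialD k f y := by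
  have h1 := (hasDerivAt_inv h0).comp_hasFDerivAt y hf.hasFDerivAt
  have h2 : fderiv ℝ (fun z => (f z)⁻¹) y = _ := h1.fderiv
  simp only [partialD]; rw [h2]; simp

namespace ExtendsSmoothly

theorem congr (hf : ExtendsSmoothly R y₀ f) (h : g =ᶠ[𝓝[interior R] y₀] f) :
    ExtendsSmoothly R y₀ g := by
  obtain ⟨F, hF, hfF⟩ := hf
  exact ⟨F, hF, h.trans hfF⟩

theorem of_contDiffWithinAt (hf : ContDiffWithinAt ℝ ∞ f R y₀) : ExtendsSmoothly R y₀ f :=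
  ⟨f, hf, EventuallyEq.rfl⟩

@[fun_prop]
theorem const (c : ℝ) : ExtendsSmoothly R y₀ fun _ => c :=
  of_contDiffWithinAt contDiffWithinAt_const

@[fun_prop]
theorem add (hf : ExtendsSmoothly R y₀ f) (hg : ExtendsSmoothly R y₀ g) :
    ExtendsSmoothly R y₀ fun y => f y + g y := by
  obtain ⟨F, hF, hfF⟩ := hf
  obtain ⟨G, hG, hgG⟩ := hg
  exact ⟨fun y => F y + G y, hF.add hG, hfF.add hgG⟩

@[fun_prop]
theorem mul (hf : ExtendsSmoothly R y₀ f) (hg : ExtendsSmoothly R y₀ g) :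
    ExtendsSmoothly R y₀ fun y => f y * g y := by
  obtain ⟨F, hF, hfF⟩ := hf
  obtain ⟨G, hG, hgG⟩ := hg
  exact ⟨fun y => F y * G y, hF.mul hG, hfF.mul hgG⟩

@[fun_prop]
theorem neg (hf : ExtendsSmoothly R y₀ f) : ExtendsSmoothly R y₀ fun y => -f y := by
  obtain ⟨F, hF, hfF⟩ := hf
  exact ⟨fun y => -F y, hF.neg, hfF.neg⟩

@[fun_prop]
theorem sub (hf : ExtendsSmoothly R y₀ f) (hg : ExtendsSmoothly R y₀ g) :
    ExtendsSmoothly R y₀ fun y => f y - g y := by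
  obtain ⟨F, hF, hfF⟩ := hf
  obtain ⟨G, hG, hgG⟩ := hg
  exact ⟨fun y => F y - G y, hF.sub hG, hfF.sub hgG⟩

@[fun_prop]
theorem pow (hf : ExtendsSmoothly R y₀ f) (m : ℕ) : ExtendsSmoothly R y₀ fun y => f y ^ m := by
  obtain ⟨F, hF, hfF⟩ := hf
  exact ⟨fun y => F y ^ m, hF.pow m, hfF.pow_const m⟩

@[fun_prop]
theorem sum {ι : Type*} {s : Finset ι} {F : ι → EuclideanSpace ℝ (Fin n) → ℝ}
    (hF : ∀ i ∈ s, ExtendsSmoothly R y₀ (F i)) :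
    ExtendsSmoothly R y₀ fun y => ∑ i ∈ s, F i y := by
  classical
  induction s using Finset.induction_on with
  | empty => simpa using const 0
  | insert a s ha ih =>
    simp only [Finset.sum_insert ha]
    exact (hF a (by simp)).add (ih fun i hi => hF i (by simp [hi]))

@[fun_prop]
theorem prod {ι : Type*} {s : Finset ι} {F : ι → EuclideanSpace ℝ (Fin n) → ℝ}
    (hF : ∀ i ∈ s, ExtendsSmoothly R y₀ (F i)) :
    ExtendsSmoothly R y₀ fun y => ∏ i ∈ s, F i y := by
  classical
  induction s using Finset.induction_on with
  | empty => simpa using const 1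
  | insert a s ha ih =>
    simp only [Finset.prod_insert ha]
    exact (hF a (by simp)).mul (ih fun i hi => hF i (by simp [hi]))

theorem exists_tendsto (hf : ExtendsSmoothly R y₀ f) :
    ∃ c, Tendsto f (𝓝[interior R] y₀) (𝓝 c) := by
  obtain ⟨F, hF, hfF⟩ := hf
  exact ⟨F y₀, (hF.continuousWithinAt.mono interior_subset).tendsto.congr' hfF.symm⟩

/-- The limit along the interior determines the value at `y₀` of the smooth extension, provided `y₀`
is in the closure of the interior; this is the role of `NeBot`. -/
theorem inv [NeBot (𝓝[interior R] y₀)] (hf : ExtendsSmoothly R y₀ f) {c : ℝ}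
    (h : Tendsto f (𝓝[interior R] y₀) (𝓝 c)) (hc : c ≠ 0) :
    ExtendsSmoothly R y₀ fun y => (f y)⁻¹ := by
  obtain ⟨F, hF, hfF⟩ := hf
  have h1 : F y₀ = c := tendsto_nhds_unique
    ((hF.continuousWithinAt.mono interior_subset).tendsto.congr' hfF.symm) h
  refine ⟨fun y => (F y)⁻¹, hF.inv (h1 ▸ hc), ?_⟩
  filter_upwards [hfF] with y hy
  rw [hy]

theorem tendsto_mul_zero {w : EuclideanSpace ℝ (Fin n) → ℝ}
    (hw : Tendsto w (𝓝[interior R] y₀) (𝓝 0)) (hf : ExtendsSmoothly R y₀ f) :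
    Tendsto (fun y => w y * f y) (𝓝[interior R] y₀) (𝓝 0) := by
  obtain ⟨c, hc⟩ := hf.exists_tendsto
  simpa using hw.mul hc

theorem eventually_contDiffAt (hy₀ : y₀ ∈ R) (hf : ExtendsSmoothly R y₀ f)
    (m : ℕ) : ∀ᶠ y in 𝓝[interior R] y₀, ContDiffAt ℝ m f y := by
  obtain ⟨F, hF, hfF⟩ := hf
  have h1 : ∀ᶠ y in 𝓝[insert y₀ R] y₀, ContDiffWithinAt ℝ m F R y :=
    (hF.of_le (by exact_mod_cast le_top)).eventually (by simp)
  rw [insert_eq_of_mem hy₀] at h1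
  filter_upwards [eventually_eventually_nhds_of_interior hfF,
    h1.filter_mono (nhdsWithin_mono _ interior_subset), self_mem_nhdsWithin] with y h2 h3 h4
  exact (h3.contDiffAt (mem_interior_iff_mem_nhds.1 h4)).congr_of_eventuallyEq h2

theorem eventually_differentiableAt (hy₀ : y₀ ∈ R)
    (hf : ExtendsSmoothly R y₀ f) :
    ∀ᶠ y in 𝓝[interior R] y₀, DifferentiableAt ℝ f y := by
  filter_upwards [hf.eventually_contDiffAt hy₀ 1] with y hy
  exact hy.differentiableAt (by simp)

@[fun_prop]
-- The extension of `∂ₖ f` is the derivative within `R` of the extension of `f`; unique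
-- differentiability keeps it smooth up to the boundary.
theorem partialD (hR : UniqueDiffOn ℝ R) (hy₀ : y₀ ∈ R) (hf : ExtendsSmoothly R y₀ f)
    (k : Fin n) : ExtendsSmoothly R y₀ (partialD k f) := by
  obtain ⟨F, hF, hfF⟩ := hf
  refine ⟨fun y => fderivWithin ℝ F R y (EuclideanSpace.single k 1),
    (hF.fderivWithin_right hR (by simp) hy₀).clm_apply contDiffWithinAt_const, ?_⟩
  filter_upwards [eventually_eventually_nhds_of_interior hfF, self_mem_nhdsWithin] with y h1 h2
  rw [partialD_congr h1, SpatialInfinity.partialD,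
    fderivWithin_of_mem_nhds (mem_interior_iff_mem_nhds.1 h2)]

theorem eventually_partialD_comm (hy₀ : y₀ ∈ R)
    (hf : ExtendsSmoothly R y₀ f) : ∀ᶠ y in 𝓝[interior R] y₀, ∀ i j,
      SpatialInfinity.partialD i (SpatialInfinity.partialD j f) y
        = SpatialInfinity.partialD j (SpatialInfinity.partialD i f) y := by
  filter_upwards [hf.eventually_contDiffAt hy₀ 2] with y hy i j
  have h1 : IsSymmSndFDerivAt ℝ f y := hy.isSymmSndFDerivAt (by simp)
  have h2 : DifferentiableAt ℝ (fderiv ℝ f) y :=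
    (hy.fderiv_right (m := 1) (by norm_num)).differentiableAt (by simp)
  have h3 : ∀ a b : Fin n, SpatialInfinity.partialD a (SpatialInfinity.partialD b f) y
      = fderiv ℝ (fderiv ℝ f) y (EuclideanSpace.single a 1) (EuclideanSpace.single b 1) := by
    intro a b
    have h4 := fderiv_clm_apply h2 (differentiableAt_const (EuclideanSpace.single b (1 : ℝ)))
    change fderiv ℝ (fun z => fderiv ℝ f z (EuclideanSpace.single b 1)) y _ = _
    rw [h4]; simp
  rw [h3, h3, h1]

end ExtendsSmoothly

end Calculus

/-! Local geometry of the metric `G = Q - w⁻² dw ⊗ dw`. -/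

/-- The metric `Q - w⁻² dw ⊗ dw`. -/
def cylinderMetric (w : EuclideanSpace ℝ (Fin 4) → ℝ)
    (Q : EuclideanSpace ℝ (Fin 4) → Matrix (Fin 4) (Fin 4) ℝ) (y : EuclideanSpace ℝ (Fin 4)) :
    Matrix (Fin 4) (Fin 4) ℝ :=
  Matrix.of fun i j => Q y i j - (w y)⁻¹ ^ 2 * (partialD i w y * partialD j w y)

/-- The Christoffel symbol `Γ_{l,ij}` of `Q` with all indices lowered. -/
def lowerChristoffel (Q : EuclideanSpace ℝ (Fin 4) → Matrix (Fin 4) (Fin 4) ℝ)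
    (y : EuclideanSpace ℝ (Fin 4)) (l i j : Fin 4) : ℝ :=
  (1 / 2) * (partialD i (fun z => Q z l j) y + partialD j (fun z => Q z l i) y
    - partialD l (fun z => Q z i j) y)

/-- The part `H^{kl} Γ_{l,ij} - Nᵏ ∂ᵢ∂ⱼw` of the Levi-Civita connection of `Q - w⁻² dw ⊗ dw` that is
regular at `w = 0`. -/
def regularConnection (w : EuclideanSpace ℝ (Fin 4) → ℝ)
    (Q H : EuclideanSpace ℝ (Fin 4) → Matrix (Fin 4) (Fin 4) ℝ)
    (N : EuclideanSpace ℝ (Fin 4) → Fin 4 → ℝ) (y : EuclideanSpace ℝ (Fin 4)) (k i j : Fin 4) : ℝ :=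
  ∑ l, H y k l * lowerChristoffel Q y l i j - N y k * partialD i (partialD j w) y

/-- The coefficient `J` in `w_e Kᵉ_{ij} = ∂ᵢ∂ⱼw + w² J_{ij}`, for the regular connection `K`. -/
def secondOrderDefect (w : EuclideanSpace ℝ (Fin 4) → ℝ)
    (Q : EuclideanSpace ℝ (Fin 4) → Matrix (Fin 4) (Fin 4) ℝ)
    (N : EuclideanSpace ℝ (Fin 4) → Fin 4 → ℝ) (σ : EuclideanSpace ℝ (Fin 4) → ℝ)
    (y : EuclideanSpace ℝ (Fin 4)) (i j : Fin 4) : ℝ :=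
  ∑ l, N y l * lowerChristoffel Q y l i j - σ y * partialD i (partialD j w) y

/-- The curvature `Rᶜ_{dab}` of the connection with coefficients `Γ`. -/
def curvature (Γ : EuclideanSpace ℝ (Fin 4) → Fin 4 → Fin 4 → Fin 4 → ℝ)
    (y : EuclideanSpace ℝ (Fin 4)) (c d a b : Fin 4) : ℝ :=
  partialD a (fun z => Γ z c b d) y - partialD b (fun z => Γ z c a d) y
    + ∑ e, (Γ y c a e * Γ y e b d - Γ y c b e * Γ y e a d)

/-- The covariant derivative `∂ₐNᶜ + Γᶜ_{ae}Nᵉ`. -/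
def covariantD (Γ : EuclideanSpace ℝ (Fin 4) → Fin 4 → Fin 4 → Fin 4 → ℝ)
    (N : EuclideanSpace ℝ (Fin 4) → Fin 4 → ℝ)
    (y : EuclideanSpace ℝ (Fin 4)) (a c : Fin 4) : ℝ :=
  partialD a (fun z => N z c) y + ∑ e, Γ y c a e * N y e

theorem curvature_congr {Γ Γ' : EuclideanSpace ℝ (Fin 4) → Fin 4 → Fin 4 → Fin 4 → ℝ}
    {y : EuclideanSpace ℝ (Fin 4)} (h : Γ =ᶠ[𝓝 y] Γ') : curvature Γ y = curvature Γ' y := by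
  have h1 : ∀ k c b d, partialD k (fun z => Γ z c b d) y = partialD k (fun z => Γ' z c b d) y := by
    intro k c b d
    exact partialD_congr (h.mono fun z hz => by simp [hz])
  ext c d a b
  simp only [curvature, h1, h.eq_of_nhds]

theorem christoffel_congr {G G' : EuclideanSpace ℝ (Fin 4) → Matrix (Fin 4) (Fin 4) ℝ}
    {y : EuclideanSpace ℝ (Fin 4)} (h : G =ᶠ[𝓝 y] G') : christoffel G y = christoffel G' y := by
  have h1 : ∀ k i j, partialD k (fun z => G z i j) y = partialD k (fun z => G' z i j) y := by
    intro k i j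
    exact partialD_congr (h.mono fun z hz => by simp [hz])
  ext k i j
  simp only [christoffel, h1, h.eq_of_nhds]

theorem riemann_congr {G G' : EuclideanSpace ℝ (Fin 4) → Matrix (Fin 4) (Fin 4) ℝ}
    {y : EuclideanSpace ℝ (Fin 4)} (h : G =ᶠ[𝓝 y] G') : riemann G y = riemann G' y :=
  curvature_congr (h.eventuallyEq_nhds.mono fun _ hz => christoffel_congr hz)

/-- The coordinate data of an asymptote at the boundary point `y₀` of the half-space `R`: `w` is the
function `Ω`, `H` is the inverse of `G = Q - w⁻² dw ⊗ dw`, and `N = w⁻² H(dw, ·)`. -/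
structure AsymptoteData (R : Set (EuclideanSpace ℝ (Fin 4))) (y₀ : EuclideanSpace ℝ (Fin 4))
    (w : EuclideanSpace ℝ (Fin 4) → ℝ)
    (Q H : EuclideanSpace ℝ (Fin 4) → Matrix (Fin 4) (Fin 4) ℝ)
    (N : EuclideanSpace ℝ (Fin 4) → Fin 4 → ℝ) (σ : EuclideanSpace ℝ (Fin 4) → ℝ) : Prop where
  uniqueDiffOn : UniqueDiffOn ℝ R
  mem : y₀ ∈ R
  w_smooth : ExtendsSmoothly R y₀ w
  Q_smooth : ∀ i j, ExtendsSmoothly R y₀ fun y => Q y i j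
  H_smooth : ∀ i j, ExtendsSmoothly R y₀ fun y => H y i j
  N_smooth : ∀ i, ExtendsSmoothly R y₀ fun y => N y i
  σ_smooth : ExtendsSmoothly R y₀ σ
  w_tendsto : Tendsto w (𝓝[interior R] y₀) (𝓝 0)
  w_ne_zero : ∀ᶠ y in 𝓝[interior R] y₀, w y ≠ 0
  Q_symm : ∀ᶠ y in 𝓝[interior R] y₀, ∀ i j, Q y i j = Q y j i
  H_mul : ∀ᶠ y in 𝓝[interior R] y₀, H y * cylinderMetric w Q y = 1
  H_dw : ∀ᶠ y in 𝓝[interior R] y₀, ∀ k, ∑ l, H y k l * partialD l w y = w y ^ 2 * N y k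
  Q_N : ∀ᶠ y in 𝓝[interior R] y₀, ∀ i, ∑ j, Q y i j * N y j = σ y * partialD i w y
  dw_N : ∀ᶠ y in 𝓝[interior R] y₀, ∑ i, partialD i w y * N y i = -1 + w y ^ 2 * σ y

theorem differentiableAt_inv_of_ne {n : ℕ} {w : EuclideanSpace ℝ (Fin n) → ℝ}
    {y : EuclideanSpace ℝ (Fin n)} (hw : DifferentiableAt ℝ w y) (h0 : w y ≠ 0) :
    DifferentiableAt ℝ (fun z => (w z)⁻¹) y :=
  hw.inv h0

namespace AsymptoteData

variable {R : Set (EuclideanSpace ℝ (Fin 4))} {y₀ : EuclideanSpace ℝ (Fin 4)}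
    {w : EuclideanSpace ℝ (Fin 4) → ℝ}
    {Q H : EuclideanSpace ℝ (Fin 4) → Matrix (Fin 4) (Fin 4) ℝ}
    {N : EuclideanSpace ℝ (Fin 4) → Fin 4 → ℝ} {σ : EuclideanSpace ℝ (Fin 4) → ℝ}

theorem partialD_w_smooth (h : AsymptoteData R y₀ w Q H N σ) (i : Fin 4) :
    ExtendsSmoothly R y₀ (partialD i w) :=
  h.w_smooth.partialD h.uniqueDiffOn h.mem i

theorem eventually_differentiableAt_partialD (h : AsymptoteData R y₀ w Q H N σ) :
    ∀ᶠ y in 𝓝[interior R] y₀, ∀ i, DifferentiableAt ℝ (partialD i w) y :=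
  eventually_all.2 fun i => (h.partialD_w_smooth i).eventually_differentiableAt h.mem

theorem eventually_differentiableAt_N (h : AsymptoteData R y₀ w Q H N σ) :
    ∀ᶠ y in 𝓝[interior R] y₀, ∀ i, DifferentiableAt ℝ (fun z => N z i) y :=
  eventually_all.2 fun i => (h.N_smooth i).eventually_differentiableAt h.mem

theorem lowerChristoffel_smooth (h : AsymptoteData R y₀ w Q H N σ) (l i j : Fin 4) :
    ExtendsSmoothly R y₀ fun y => lowerChristoffel Q y l i j := by
  have h1 := h.uniqueDiffOn
  have h2 := h.mem
  have h3 := h.Q_smooth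
  unfold lowerChristoffel
  fun_prop (disch := assumption)

theorem regularConnection_smooth (h : AsymptoteData R y₀ w Q H N σ) (k i j : Fin 4) :
    ExtendsSmoothly R y₀ fun y => regularConnection w Q H N y k i j := by
  have h1 := h.uniqueDiffOn
  have h2 := h.mem
  have h3 := h.H_smooth
  have h4 := h.N_smooth
  have h5 := h.w_smooth
  have h6 := h.lowerChristoffel_smooth
  unfold regularConnection
  fun_prop (disch := assumption)

theorem secondOrderDefect_smooth (h : AsymptoteData R y₀ w Q H N σ) (i j : Fin 4) :
    ExtendsSmoothly R y₀ fun y => secondOrderDefect w Q N σ y i j := by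
  have h1 := h.uniqueDiffOn
  have h2 := h.mem
  have h3 := h.σ_smooth
  have h4 := h.N_smooth
  have h5 := h.w_smooth
  have h6 := h.lowerChristoffel_smooth
  unfold secondOrderDefect
  fun_prop (disch := assumption)

theorem curvature_regularConnection_smooth (h : AsymptoteData R y₀ w Q H N σ) (c d a b : Fin 4) :
    ExtendsSmoothly R y₀ fun y => curvature (regularConnection w Q H N) y c d a b := by
  have h1 := h.uniqueDiffOn
  have h2 := h.mem
  have h3 := h.regularConnection_smooth
  unfold curvature
  fun_prop (disch := assumption)

theorem covariantD_smooth (h : AsymptoteData R y₀ w Q H N σ) (a c : Fin 4) :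
    ExtendsSmoothly R y₀ fun y => covariantD (regularConnection w Q H N) N y a c := by
  have h1 := h.uniqueDiffOn
  have h2 := h.mem
  have h3 := h.regularConnection_smooth
  have h4 := h.N_smooth
  unfold covariantD
  fun_prop (disch := assumption)

theorem partialD_cylinderMetric (h : AsymptoteData R y₀ w Q H N σ) :
    ∀ᶠ y in 𝓝[interior R] y₀, ∀ k i j, DifferentiableAt ℝ (fun z => cylinderMetric w Q z i j) y ∧
      partialD k (fun z => cylinderMetric w Q z i j) y = partialD k (fun z => Q z i j) y
        + 2 * (w y)⁻¹ ^ 3 * partialD k w y * partialD i w y * partialD j w y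
        - (w y)⁻¹ ^ 2 * (partialD k (partialD i w) y * partialD j w y
          + partialD i w y * partialD k (partialD j w) y) := by
  have hQ : ∀ᶠ y in 𝓝[interior R] y₀, ∀ i j, DifferentiableAt ℝ (fun z => Q z i j) y :=
    eventually_all.2 fun i => eventually_all.2 fun j =>
      (h.Q_smooth i j).eventually_differentiableAt h.mem
  filter_upwards [hQ, h.w_smooth.eventually_differentiableAt h.mem,
    h.eventually_differentiableAt_partialD, h.w_ne_zero] with y h1 h2 h3 h4 k i j
  have h5 := differentiableAt_inv_of_ne h2 h4
  have h6 : DifferentiableAt ℝ (fun z => (w z)⁻¹ * (w z)⁻¹) y := h5.mul h5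
  have h7 : DifferentiableAt ℝ (fun z => partialD i w z * partialD j w z) y := (h3 i).mul (h3 j)
  have h8 : (fun z => cylinderMetric w Q z i j) = fun z => Q z i j
      - (w z)⁻¹ * (w z)⁻¹ * (partialD i w z * partialD j w z) := by
    ext z; simp [cylinderMetric, sq]
  have h9 : DifferentiableAt ℝ
      (fun z => (w z)⁻¹ * (w z)⁻¹ * (partialD i w z * partialD j w z)) y := h6.mul h7
  rw [h8]
  refine ⟨(h1 i j).sub h9, ?_⟩
  rw [partialD_sub (h1 i j) h9, partialD_mul h6 h7, partialD_mul h5 h5,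
    partialD_mul (h3 i) (h3 j), partialD_inv h2 h4]
  ring

theorem inv_cylinderMetric (h : AsymptoteData R y₀ w Q H N σ) :
    ∀ᶠ y in 𝓝[interior R] y₀, (cylinderMetric w Q y)⁻¹ = H y :=
  h.H_mul.mono fun _ hy => Matrix.inv_eq_left_inv hy

/-- In `∂ᵢG_{lj} + ∂ⱼG_{li} - ∂_lG_{ij}` all singular terms other than multiples of `∂_l w` cancel.
What remains of order `w⁻³` and `w⁻²` is contracted by `H` to `w² N`, so only a simple pole
survives. -/
theorem christoffel_cylinderMetric (h : AsymptoteData R y₀ w Q H N σ) :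
    ∀ᶠ y in 𝓝[interior R] y₀, ∀ k i j, christoffel (cylinderMetric w Q) y k i j
      = regularConnection w Q H N y k i j
        + (w y)⁻¹ * N y k * (partialD i w y * partialD j w y) := by
  filter_upwards [h.partialD_cylinderMetric, h.inv_cylinderMetric, h.H_dw, h.w_ne_zero,
    h.w_smooth.eventually_partialD_comm h.mem] with y h1 h2 h3 h4 h5 k i j
  have h3 := h3 k
  have e1 : w y ^ 2 * (w y)⁻¹ ^ 2 = 1 := by field_simp
  have e2 : w y ^ 2 * (w y)⁻¹ ^ 3 = (w y)⁻¹ := by field_simp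
  simp only [christoffel, regularConnection, lowerChristoffel, h2, fun a b c => (h1 a b c).2,
    Fin.sum_univ_four] at h3 ⊢
  rw [h5 0 i, h5 0 j, h5 1 i, h5 1 j, h5 2 i, h5 2 j, h5 3 i, h5 3 j, h5 j i]
  linear_combination ((w y)⁻¹ ^ 3 * partialD i w y * partialD j w y
    - (w y)⁻¹ ^ 2 * partialD i (partialD j w) y) * h3
    + N y k * partialD i w y * partialD j w y * e2 - N y k * partialD i (partialD j w) y * e1

theorem H_symm (h : AsymptoteData R y₀ w Q H N σ) :
    ∀ᶠ y in 𝓝[interior R] y₀, ∀ i j, H y i j = H y j i := by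
  filter_upwards [h.inv_cylinderMetric, h.Q_symm] with y h1 h2 i j
  have h3 : (cylinderMetric w Q y).transpose = cylinderMetric w Q y := by
    ext i j
    simp only [cylinderMetric, Matrix.transpose_apply, Matrix.of_apply, h2 j i]
    ring
  have h4 : (H y).transpose = H y := by rw [← h1, Matrix.transpose_nonsing_inv, h3]
  exact congrFun (congrFun h4 j) i

theorem dw_H (h : AsymptoteData R y₀ w Q H N σ) :
    ∀ᶠ y in 𝓝[interior R] y₀, ∀ k, ∑ l, partialD l w y * H y l k = w y ^ 2 * N y k := by
  filter_upwards [h.H_symm, h.H_dw] with y h1 h2 k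
  rw [← h2]
  exact Finset.sum_congr rfl fun l _ => by rw [h1 k l, mul_comm]

/-- For the regular connection the Hessian of `w` is thus `-w² J`: the level sets of `w` are totally
geodesic to second order. The two inputs are `dw · H = w² N` and `dw · N = -1 + w² σ`. -/
theorem dw_regularConnection (h : AsymptoteData R y₀ w Q H N σ) :
    ∀ᶠ y in 𝓝[interior R] y₀, ∀ i j, ∑ e, partialD e w y * regularConnection w Q H N y e i j
      = partialD i (partialD j w) y + w y ^ 2 * secondOrderDefect w Q N σ y i j := by
  filter_upwards [h.dw_H, h.dw_N] with y h1 h2 i j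
  have k0 := h1 0
  have k1 := h1 1
  have k2 := h1 2
  have k3 := h1 3
  simp only [regularConnection, secondOrderDefect, Fin.sum_univ_four] at *
  linear_combination lowerChristoffel Q y 0 i j * k0 + lowerChristoffel Q y 1 i j * k1
    + lowerChristoffel Q y 2 i j * k2 + lowerChristoffel Q y 3 i j * k3
    - partialD i (partialD j w) y * h2

end AsymptoteData

/-! ### Expansion of the Riemann tensor in powers of `w`. -/

namespace AsymptoteData

variable {R : Set (EuclideanSpace ℝ (Fin 4))} {y₀ : EuclideanSpace ℝ (Fin 4)}
    {w : EuclideanSpace ℝ (Fin 4) → ℝ}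
    {Q H : EuclideanSpace ℝ (Fin 4) → Matrix (Fin 4) (Fin 4) ℝ}
    {N : EuclideanSpace ℝ (Fin 4) → Fin 4 → ℝ} {σ : EuclideanSpace ℝ (Fin 4) → ℝ}

/-- The `w⁻²` terms, from the derivative of `w⁻¹` and from the product of the two singular parts,
are symmetric in `a`, `b` and drop out of the curvature. The Hessian of `w` combines with `dw · K`
to leave only `w J`. -/
theorem riemann_cylinderMetric (h : AsymptoteData R y₀ w Q H N σ) :
    ∀ᶠ y in 𝓝[interior R] y₀, ∀ c d a b, riemann (cylinderMetric w Q) y c d a b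
      = curvature (regularConnection w Q H N) y c d a b
        + (w y)⁻¹ * (covariantD (regularConnection w Q H N) N y a c
            * (partialD b w y * partialD d w y)
          - covariantD (regularConnection w Q H N) N y b c * (partialD a w y * partialD d w y))
        + w y * N y c * (partialD a w y * secondOrderDefect w Q N σ y b d
          - partialD b w y * secondOrderDefect w Q N σ y a d) := by
  have hK : ∀ᶠ y in 𝓝[interior R] y₀, ∀ k i j,
      DifferentiableAt ℝ (fun z => regularConnection w Q H N z k i j) y :=
    eventually_all.2 fun k => eventually_all.2 fun i => eventually_all.2 fun j =>
      (h.regularConnection_smooth k i j).eventually_differentiableAt h.mem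
  have hΓ : ∀ᶠ y in 𝓝[interior R] y₀, christoffel (cylinderMetric w Q) y
      = fun k i j => regularConnection w Q H N y k i j
        + (w y)⁻¹ * N y k * (partialD i w y * partialD j w y) :=
    h.christoffel_cylinderMetric.mono fun y hy => by ext k i j; exact hy k i j
  filter_upwards [eventually_eventually_nhds_of_interior hΓ, hK, h.w_ne_zero,
    h.w_smooth.eventually_differentiableAt h.mem, h.eventually_differentiableAt_partialD,
    h.eventually_differentiableAt_N, h.w_smooth.eventually_partialD_comm h.mem,
    h.dw_regularConnection] with y h1 h2 h3 h4 h5 h6 h7 h8 c d a b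
  have d1 := differentiableAt_inv_of_ne h4 h3
  have d2 : ∀ k, DifferentiableAt ℝ (fun z => (w z)⁻¹ * N z k) y := fun k => d1.mul (h6 k)
  have d3 : ∀ i j, DifferentiableAt ℝ (fun z => partialD i w z * partialD j w z) y :=
    fun i j => (h5 i).mul (h5 j)
  have d4 : ∀ k i j, DifferentiableAt ℝ
      (fun z => (w z)⁻¹ * N z k * (partialD i w z * partialD j w z)) y :=
    fun k i j => (d2 k).mul (d3 i j)
  have e0 : (w y)⁻¹ * w y ^ 2 = w y := by field_simp
  have k1 := h8 a d
  have k2 := h8 b d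
  change curvature (christoffel (cylinderMetric w Q)) y c d a b = _
  rw [curvature_congr h1]
  simp only [curvature, covariantD, Fin.sum_univ_four] at k1 k2 ⊢
  rw [partialD_add (h2 c b d) (d4 c b d), partialD_add (h2 c a d) (d4 c a d),
    partialD_mul (d2 c) (d3 b d), partialD_mul (d2 c) (d3 a d), partialD_mul d1 (h6 c),
    partialD_mul d1 (h6 c), partialD_mul (h5 b) (h5 d), partialD_mul (h5 a) (h5 d),
    partialD_inv h4 h3, partialD_inv h4 h3, h7 b a]
  linear_combination (w y)⁻¹ * N y c * partialD a w y * k2 - (w y)⁻¹ * N y c * partialD b w y * k1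
    + N y c * (partialD a w y * secondOrderDefect w Q N σ y b d
          - partialD b w y * secondOrderDefect w Q N σ y a d) * e0

/-- This is the Ricci identity for the covector `dw`, whose covariant derivative is `-w² J`. It is
obtained by differentiating `dw_regularConnection` and antisymmetrising, which removes the third
derivatives of `w`. -/
theorem dw_curvature_regularConnection (h : AsymptoteData R y₀ w Q H N σ) :
    ∀ᶠ y in 𝓝[interior R] y₀, ∀ d a b,
      ∑ e, partialD e w y * curvature (regularConnection w Q H N) y e d a b
        = w y * (2 * (partialD a w y * secondOrderDefect w Q N σ y b d
            - partialD b w y * secondOrderDefect w Q N σ y a d)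
          + w y * (partialD a (fun z => secondOrderDefect w Q N σ z b d) y
            - partialD b (fun z => secondOrderDefect w Q N σ z a d) y
            + ∑ e, (secondOrderDefect w Q N σ y a e * regularConnection w Q H N y e b d
              - secondOrderDefect w Q N σ y b e * regularConnection w Q H N y e a d))) := by
  have hK : ∀ᶠ y in 𝓝[interior R] y₀, ∀ k i j,
      DifferentiableAt ℝ (fun z => regularConnection w Q H N z k i j) y :=
    eventually_all.2 fun k => eventually_all.2 fun i => eventually_all.2 fun j =>
      (h.regularConnection_smooth k i j).eventually_differentiableAt h.mem
  have hJ : ∀ᶠ y in 𝓝[interior R] y₀, ∀ i j,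
      DifferentiableAt ℝ (fun z => secondOrderDefect w Q N σ z i j) y :=
    eventually_all.2 fun i => eventually_all.2 fun j =>
      (h.secondOrderDefect_smooth i j).eventually_differentiableAt h.mem
  have hw2 : ∀ᶠ y in 𝓝[interior R] y₀, ∀ i j, DifferentiableAt ℝ (partialD i (partialD j w)) y :=
    eventually_all.2 fun i => eventually_all.2 fun j =>
      ((h.partialD_w_smooth j).partialD h.uniqueDiffOn h.mem i).eventually_differentiableAt h.mem
  have hw3 : ∀ᶠ y in 𝓝[interior R] y₀, ∀ d a b,
      partialD a (partialD b (partialD d w)) y = partialD b (partialD a (partialD d w)) y :=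
    eventually_all.2 fun d => (h.partialD_w_smooth d).eventually_partialD_comm h.mem
  filter_upwards [eventually_eventually_nhds_of_interior h.dw_regularConnection,
    hK, hJ, hw2, hw3, h.w_smooth.eventually_differentiableAt h.mem,
    h.eventually_differentiableAt_partialD, h.w_smooth.eventually_partialD_comm h.mem]
    with y h1 h2 h3 h4 h5 h6 h7 h8 d a b
  have d1 : DifferentiableAt ℝ (fun z => w z * w z) y := h6.mul h6
  have d2 : ∀ i j, DifferentiableAt ℝ (fun z => w z * w z * secondOrderDefect w Q N σ z i j) y :=
    fun i j => d1.mul (h3 i j)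
  have d3 : ∀ e i j, DifferentiableAt ℝ
      (fun z => partialD e w z * regularConnection w Q H N z e i j) y :=
    fun e i j => (h7 e).mul (h2 e i j)
  have key : ∀ a i j, ∑ e, (partialD a (partialD e w) y * regularConnection w Q H N y e i j
      + partialD e w y * partialD a (fun z => regularConnection w Q H N z e i j) y)
      = partialD a (partialD i (partialD j w)) y + (2 * w y * partialD a w y
        * secondOrderDefect w Q N σ y i j
        + w y ^ 2 * partialD a (fun z => secondOrderDefect w Q N σ z i j) y) := by
    intro a i j
    have t1 : partialD a (fun z => ∑ e, partialD e w z * regularConnection w Q H N z e i j) y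
        = partialD a (fun z => partialD i (partialD j w) z
          + w z * w z * secondOrderDefect w Q N σ z i j) y :=
      partialD_congr (h1.mono fun z hz => by simp only [hz i j, sq])
    rw [partialD_sum fun e _ => d3 e i j, partialD_add (h4 i j) (d2 i j),
      partialD_mul d1 (h3 i j), partialD_mul h6 h6] at t1
    simp only [partialD_mul (h7 _) (h2 _ i j)] at t1
    rw [t1]; ring
  have k1 := key a b d
  have k2 := key b a d
  have k3 := h1.self_of_nhds
  have s1 := h5 d a b
  have l1 := k3 a
  have l2 := k3 b
  have l10 := l1 0
  have l11 := l1 1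
  have l12 := l1 2
  have l13 := l1 3
  have l20 := l2 0
  have l21 := l2 1
  have l22 := l2 2
  have l23 := l2 3
  clear l1 l2 key h1 d1 d2 d3 h2 h3 h4 h6 h7 k3
  simp only [curvature, Fin.sum_univ_four] at *
  linear_combination k1 - k2 + s1 + regularConnection w Q H N y 0 b d * l10
    + regularConnection w Q H N y 1 b d * l11 + regularConnection w Q H N y 2 b d * l12
    + regularConnection w Q H N y 3 b d * l13 - regularConnection w Q H N y 0 a d * l20
    - regularConnection w Q H N y 1 a d * l21 - regularConnection w Q H N y 2 a d * l22
    - regularConnection w Q H N y 3 a d * l23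

/-- Derivative of `dw · N = -1 + w² σ`; the Hessian of `w` contributes only at order `w²`. -/
theorem dw_covariantD (h : AsymptoteData R y₀ w Q H N σ) :
    ∀ᶠ y in 𝓝[interior R] y₀, ∀ a,
      ∑ c, partialD c w y * covariantD (regularConnection w Q H N) N y a c
        = 2 * w y * σ y * partialD a w y + w y ^ 2 * (partialD a σ y
          + ∑ e, secondOrderDefect w Q N σ y a e * N y e) := by
  filter_upwards [eventually_eventually_nhds_of_interior h.dw_N,
    h.dw_regularConnection, h.w_smooth.eventually_differentiableAt h.mem,
    h.σ_smooth.eventually_differentiableAt h.mem,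
    h.eventually_differentiableAt_partialD, h.eventually_differentiableAt_N] with
    y h1 h2 h3 h4 h5 h6 a
  have d1 : DifferentiableAt ℝ (fun z => w z * w z) y := h3.mul h3
  have d2 : DifferentiableAt ℝ (fun z => w z * w z * σ z) y := d1.mul h4
  have d3 : ∀ e, DifferentiableAt ℝ (fun z => partialD e w z * N z e) y :=
    fun e => (h5 e).mul (h6 e)
  have t1 : partialD a (fun z => ∑ e, partialD e w z * N z e) y
      = partialD a (fun z => -1 + w z * w z * σ z) y :=
    partialD_congr (h1.mono fun z hz => by simp only [hz, sq])
  rw [partialD_sum fun e _ => d3 e, partialD_add (differentiableAt_const _) d2,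
    partialD_mul d1 h4, partialD_mul h3 h3, partialD_const] at t1
  simp only [partialD_mul (h5 _) (h6 _)] at t1
  have l0 := h2 a 0
  have l1 := h2 a 1
  have l2 := h2 a 2
  have l3 := h2 a 3
  clear h1 h2
  simp only [covariantD, Fin.sum_univ_four] at *
  linear_combination t1 + N y 0 * l0 + N y 1 * l1 + N y 2 * l2 + N y 3 * l3

/-- The components `w R` of the curvature of `Q - w⁻² dw ⊗ dw` extend smoothly, the contraction
`dw · R` is of order `w`, and the contraction of `R` on its second index with `H` extends
smoothly. -/
theorem exists_riemann_bounds (h : AsymptoteData R y₀ w Q H N σ) :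
    ∃ (Z X : Fin 4 → Fin 4 → Fin 4 → Fin 4 → EuclideanSpace ℝ (Fin 4) → ℝ)
      (Y : Fin 4 → Fin 4 → Fin 4 → EuclideanSpace ℝ (Fin 4) → ℝ),
      (∀ c d a b, ExtendsSmoothly R y₀ (Z c d a b)) ∧
      (∀ c d a b, ExtendsSmoothly R y₀ (X c d a b)) ∧
      (∀ d a b, ExtendsSmoothly R y₀ (Y d a b)) ∧
      ∀ᶠ y in 𝓝[interior R] y₀,
        (∀ c d a b, w y * riemann (cylinderMetric w Q) y c d a b = Z c d a b y) ∧
        (∀ d a b, ∑ e, partialD e w y * riemann (cylinderMetric w Q) y e d a b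
          = w y * Y d a b y) ∧
        ∀ r p b d, ∑ f, H y r f * riemann (cylinderMetric w Q) y p f b d = X r p b d y := by
  have h1 := h.uniqueDiffOn
  have h2 := h.mem
  have h3 := h.σ_smooth
  have h4 := h.N_smooth
  have h5 := h.w_smooth
  have h6 := h.secondOrderDefect_smooth
  have h7 := h.regularConnection_smooth
  have h8 := h.curvature_regularConnection_smooth
  have h9 := h.covariantD_smooth
  have h10 := h.H_smooth
  refine ⟨fun c d a b y => w y * curvature (regularConnection w Q H N) y c d a b
        + (covariantD (regularConnection w Q H N) N y a c * (partialD b w y * partialD d w y)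
          - covariantD (regularConnection w Q H N) N y b c * (partialD a w y * partialD d w y))
        + w y * w y * N y c * (partialD a w y * secondOrderDefect w Q N σ y b d
          - partialD b w y * secondOrderDefect w Q N σ y a d),
    fun r p b d y => ∑ f, H y r f * (curvature (regularConnection w Q H N) y p f b d
        + w y * N y p * (partialD b w y * secondOrderDefect w Q N σ y d f
          - partialD d w y * secondOrderDefect w Q N σ y b f))
        + w y * N y r * (covariantD (regularConnection w Q H N) N y b p * partialD d w y
          - covariantD (regularConnection w Q H N) N y d p * partialD b w y),
    fun d a b y => (2 * (partialD a w y * secondOrderDefect w Q N σ y b d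
            - partialD b w y * secondOrderDefect w Q N σ y a d)
          + w y * (partialD a (fun z => secondOrderDefect w Q N σ z b d) y
            - partialD b (fun z => secondOrderDefect w Q N σ z a d) y
            + ∑ e, (secondOrderDefect w Q N σ y a e * regularConnection w Q H N y e b d
              - secondOrderDefect w Q N σ y b e * regularConnection w Q H N y e a d)))
      + ((partialD a σ y + ∑ e, secondOrderDefect w Q N σ y a e * N y e)
          * (partialD b w y * partialD d w y)
        - (partialD b σ y + ∑ e, secondOrderDefect w Q N σ y b e * N y e)
          * (partialD a w y * partialD d w y))
      + (-1 + w y ^ 2 * σ y) * (partialD a w y * secondOrderDefect w Q N σ y b d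
          - partialD b w y * secondOrderDefect w Q N σ y a d), ?_, ?_, ?_, ?_⟩
  · intro c d a b; fun_prop (disch := assumption)
  · intro c d a b; fun_prop (disch := assumption)
  · intro d a b; fun_prop (disch := assumption)
  filter_upwards [h.riemann_cylinderMetric, h.w_ne_zero, h.dw_curvature_regularConnection,
    h.dw_covariantD, h.dw_N, h.H_dw] with y g1 g2 g3 g4 g5 g6
  have e0 : w y * (w y)⁻¹ = 1 := by field_simp
  refine ⟨?_, ?_, ?_⟩
  · intro c d a b
    rw [g1]
    linear_combination (covariantD (regularConnection w Q H N) N y a c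
      * (partialD b w y * partialD d w y)
      - covariantD (regularConnection w Q H N) N y b c * (partialD a w y * partialD d w y)) * e0
  -- The pole is multiplied by `dw · ∇N`, whose leading term `2 w σ dw` is cancelled by antisymmetry
  -- in `a`, `b`; the rest is of order `w²`.
  · intro d a b
    have k1 := g3 d a b
    have k2 := g4 a
    have k3 := g4 b
    have e1 : (w y)⁻¹ * w y ^ 2 = w y := by field_simp
    simp only [g1]
    generalize (∑ e, (secondOrderDefect w Q N σ y a e * regularConnection w Q H N y e b d
              - secondOrderDefect w Q N σ y b e * regularConnection w Q H N y e a d)) = S1 at *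
    generalize ∑ e, secondOrderDefect w Q N σ y a e * N y e = S2 at *
    generalize ∑ e, secondOrderDefect w Q N σ y b e * N y e = S3 at *
    simp only [Fin.sum_univ_four] at *
    linear_combination k1 + (w y)⁻¹ * partialD b w y * partialD d w y * k2
      - (w y)⁻¹ * partialD a w y * partialD d w y * k3
      + w y * (partialD a w y * secondOrderDefect w Q N σ y b d
          - partialD b w y * secondOrderDefect w Q N σ y a d) * g5
      + ((partialD a σ y + S2) * (partialD b w y * partialD d w y)
        - (partialD b σ y + S3) * (partialD a w y * partialD d w y)) * e1
  -- The polar part carries a factor `∂_f w`, which `H` turns into `w² N`.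
  · intro r p b d
    have k1 := g6 r
    have e1 : (w y)⁻¹ * w y ^ 2 = w y := by field_simp
    simp only [g1, Fin.sum_univ_four] at *
    linear_combination (w y)⁻¹ * (covariantD (regularConnection w Q H N) N y b p * partialD d w y
          - covariantD (regularConnection w Q H N) N y d p * partialD b w y) * k1
      + N y r * (covariantD (regularConnection w Q H N) N y b p * partialD d w y
          - covariantD (regularConnection w Q H N) N y d p * partialD b w y) * e1

end AsymptoteData

/-! ### The vacuum equation and the Ricci tensor of the conformal metric. -/

/-- The Ricci tensor of a symmetric connection changes by `-3 (∇ψ - ψ ⊗ ψ)` under the projective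
change with closed 1-form `ψ`. -/
theorem sum_curvature_projective {K : EuclideanSpace ℝ (Fin 4) → Fin 4 → Fin 4 → Fin 4 → ℝ}
    {ψ : Fin 4 → EuclideanSpace ℝ (Fin 4) → ℝ} {y : EuclideanSpace ℝ (Fin 4)}
    (hK : ∀ k i j, DifferentiableAt ℝ (fun z => K z k i j) y)
    (hKs : ∀ k i j, K y k i j = K y k j i) (hψ : ∀ i, DifferentiableAt ℝ (ψ i) y)
    (hψs : ∀ i j, partialD i (ψ j) y = partialD j (ψ i) y) (d b : Fin 4) :
    ∑ c, curvature (fun z k i j => K z k i j + ((1 : Matrix (Fin 4) (Fin 4) ℝ) k i * ψ j z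
        + (1 : Matrix (Fin 4) (Fin 4) ℝ) k j * ψ i z)) y c d c b
      = ∑ c, curvature K y c d c b
        - 3 * (partialD b (ψ d) y - ∑ e, K y e b d * ψ e y - ψ b y * ψ d y) := by
  have d1 : ∀ (r : ℝ) i, DifferentiableAt ℝ (fun z => r * ψ i z) y :=
    fun r i => (hψ i).const_mul r
  have d2 : ∀ (r s : ℝ) i j, DifferentiableAt ℝ (fun z => r * ψ i z + s * ψ j z) y :=
    fun r s i j => (d1 r i).add (d1 s j)
  have key : ∀ a k i j, partialD a (fun z => K z k i j + ((1 : Matrix (Fin 4) (Fin 4) ℝ) k i * ψ j z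
        + (1 : Matrix (Fin 4) (Fin 4) ℝ) k j * ψ i z)) y
      = partialD a (fun z => K z k i j) y + ((1 : Matrix (Fin 4) (Fin 4) ℝ) k i * partialD a (ψ j) y
        + (1 : Matrix (Fin 4) (Fin 4) ℝ) k j * partialD a (ψ i) y) := by
    intro a k i j
    rw [partialD_add (hK k i j) (d2 _ _ _ _), partialD_add (d1 _ _) (d1 _ _),
      partialD_mul (differentiableAt_const _) (hψ _),
      partialD_mul (differentiableAt_const _) (hψ _), partialD_const, partialD_const]
    ring
  simp only [curvature, key, Fin.sum_univ_four]
  fin_cases b <;> fin_cases d <;>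
    simp [Matrix.one_apply, hKs _ 1 0, hKs _ 2 0, hKs _ 3 0, hKs _ 2 1, hKs _ 3 1, hKs _ 3 2,
      hψs 1 0, hψs 2 0, hψs 3 0, hψs 2 1, hψs 3 1, hψs 3 2] <;> ring

namespace AsymptoteData

variable {R : Set (EuclideanSpace ℝ (Fin 4))} {y₀ : EuclideanSpace ℝ (Fin 4)}
    {w : EuclideanSpace ℝ (Fin 4) → ℝ}
    {Q H : EuclideanSpace ℝ (Fin 4) → Matrix (Fin 4) (Fin 4) ℝ}
    {N : EuclideanSpace ℝ (Fin 4) → Fin 4 → ℝ} {σ : EuclideanSpace ℝ (Fin 4) → ℝ}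

/-- Conformal change with `ψ = -dw/w`. Its trace term `-G_{ij} G^{kl} ψ_l` equals `w Nᵏ G_{ij}`, and
the polar part of this cancels the pole `w⁻¹ Nᵏ ∂ᵢw ∂ⱼw` of the connection of `G`. All remaining
singularity is projective. -/
theorem christoffel_physicalMetric (h : AsymptoteData R y₀ w Q H N σ) :
    ∀ᶠ y in 𝓝[interior R] y₀, ∀ k i j,
      christoffel (fun z => (w z)⁻¹ ^ 2 • cylinderMetric w Q z) y k i j
        = (regularConnection w Q H N y k i j + w y * (N y k * Q y i j))
          + ((1 : Matrix (Fin 4) (Fin 4) ℝ) k i * (-(w y)⁻¹ * partialD j w y)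
            + (1 : Matrix (Fin 4) (Fin 4) ℝ) k j * (-(w y)⁻¹ * partialD i w y)) := by
  filter_upwards [h.partialD_cylinderMetric, h.christoffel_cylinderMetric, h.inv_cylinderMetric,
    h.H_dw, h.w_ne_zero, h.H_mul, h.w_smooth.eventually_differentiableAt h.mem, h.Q_symm]
    with y h1 h2 h3 h4 h5 h6 h7 hs k i j
  have d1 := differentiableAt_inv_of_ne h7 h5
  have d2 : DifferentiableAt ℝ (fun z => (w z)⁻¹ * (w z)⁻¹) y := d1.mul d1
  have e1 : w y ^ 2 * (w y)⁻¹ ^ 2 = 1 := by field_simp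
  have e2 : w y * (w y)⁻¹ = 1 := by field_simp
  have t1 : ∀ a i j, partialD a (fun z => ((w z)⁻¹ ^ 2 • cylinderMetric w Q z) i j) y
      = (w y)⁻¹ ^ 2 * partialD a (fun z => cylinderMetric w Q z i j) y
        - 2 * (w y)⁻¹ ^ 3 * partialD a w y * cylinderMetric w Q y i j := by
    intro a i j
    have t2 : (fun z => ((w z)⁻¹ ^ 2 • cylinderMetric w Q z) i j)
        = fun z => (w z)⁻¹ * (w z)⁻¹ * cylinderMetric w Q z i j := by
      ext z; simp [sq]
    rw [t2, partialD_mul d2 (h1 a i j).1, partialD_mul d1 d1, partialD_inv h7 h5]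
    ring
  have hinv : ((w y)⁻¹ ^ 2 • cylinderMetric w Q y)⁻¹ = w y ^ 2 • H y := by
    apply Matrix.inv_eq_left_inv
    rw [Matrix.smul_mul, Matrix.mul_smul, h6, smul_smul, e1, one_smul]
  have hm : ∀ j, ∑ l, H y k l * cylinderMetric w Q y l j = (1 : Matrix (Fin 4) (Fin 4) ℝ) k j := by
    intro j
    have := congrFun (congrFun h6 k) j
    rwa [Matrix.mul_apply] at this
  have hi := hm i
  have hj := hm j
  have hk := h4 k
  have hΓ := h2 k i j
  have hG : cylinderMetric w Q y i j
      = Q y i j - (w y)⁻¹ ^ 2 * (partialD i w y * partialD j w y) := rfl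
  rw [christoffel, h3] at hΓ
  rw [christoffel, hinv]
  simp only [t1, Matrix.smul_apply, smul_eq_mul] at *
  rw [← hi, ← hj]
  generalize regularConnection w Q H N y k i j = K at *
  have e3 : w y ^ 2 * (w y)⁻¹ ^ 3 = (w y)⁻¹ := by field_simp
  have e4 : (w y)⁻¹ * w y ^ 2 = w y := by field_simp
  rw [show w y * (N y k * Q y i j) = w y * (N y k * cylinderMetric w Q y i j)
    + (w y)⁻¹ * N y k * (partialD i w y * partialD j w y) by
      rw [hG]; linear_combination (w y)⁻¹ * N y k * (partialD i w y * partialD j w y) * e2]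
  clear h1 h2 h3 h4 h6 hm hs hG t1 hinv d1 d2 h7 hi hj
  simp only [Fin.sum_univ_four] at *
  generalize cylinderMetric w Q y i j = gij at *
  linear_combination w y ^ 2 * (w y)⁻¹ ^ 2 * hΓ + (w y ^ 2 * (w y)⁻¹ ^ 3 * gij) * hk
    + (K + (w y)⁻¹ * N y k * (partialD i w y * partialD j w y)) * e1
    + (- partialD i w y * (H y k 0 * cylinderMetric w Q y 0 j + H y k 1 * cylinderMetric w Q y 1 j
        + H y k 2 * cylinderMetric w Q y 2 j + H y k 3 * cylinderMetric w Q y 3 j)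
      - partialD j w y * (H y k 0 * cylinderMetric w Q y 0 i + H y k 1 * cylinderMetric w Q y 1 i
        + H y k 2 * cylinderMetric w Q y 2 i + H y k 3 * cylinderMetric w Q y 3 i)
      + gij * w y ^ 2 * N y k) * e3 + gij * N y k * e4

theorem regularConnection_symm (h : AsymptoteData R y₀ w Q H N σ) :
    ∀ᶠ y in 𝓝[interior R] y₀, ∀ k i j,
      regularConnection w Q H N y k i j = regularConnection w Q H N y k j i := by
  filter_upwards [h.w_smooth.eventually_partialD_comm h.mem,
    eventually_eventually_nhds_of_interior h.Q_symm] with y h1 h2 k i j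
  have h3 : ∀ l, partialD l (fun z => Q z i j) y = partialD l (fun z => Q z j i) y :=
    fun l => partialD_congr (h2.mono fun z hz => hz i j)
  simp only [regularConnection, lowerChristoffel, h1 i j, h3]
  congr 1
  exact Finset.sum_congr rfl fun l _ => by ring

/-- The Ricci tensor of `K` is computed from Ricci-flatness and inserted in the contraction of
`riemann_cylinderMetric`. The coefficient -2 is -3 from the projective law plus 1 from removing `w N
⊗ Q`; `θ` is the divergence of `N` corrected by `-w σ`. -/
theorem exists_ricci (h : AsymptoteData R y₀ w Q H N σ)
    (hv : ∀ᶠ y in 𝓝[interior R] y₀, ∀ d b,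
      ricci (fun z => (w z)⁻¹ ^ 2 • cylinderMetric w Q z) y d b = 0) :
    ∃ (θ : EuclideanSpace ℝ (Fin 4) → ℝ) (M : Fin 4 → Fin 4 → EuclideanSpace ℝ (Fin 4) → ℝ),
      ExtendsSmoothly R y₀ θ ∧ (∀ i j, ExtendsSmoothly R y₀ (M i j)) ∧
      ∀ᶠ y in 𝓝[interior R] y₀, ∀ d b, ricci (cylinderMetric w Q) y d b
        = -2 * Q y d b + (w y)⁻¹ * θ y * (partialD d w y * partialD b w y) + w y * M d b y := by
  have h1 := h.uniqueDiffOn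
  have h2 := h.mem
  have h3 := h.σ_smooth
  have h4 := h.N_smooth
  have h5 := h.w_smooth
  have h6 := h.secondOrderDefect_smooth
  have h7 := h.regularConnection_smooth
  have h8 := h.Q_smooth
  have h9 := h.covariantD_smooth
  refine ⟨fun y => ∑ c, covariantD (regularConnection w Q H N) N y c c - w y * σ y,
    fun d b y => 2 * w y * σ y * Q y b d + 3 * secondOrderDefect w Q N σ y b d
      - (∑ c, (partialD c (fun z => N z c * Q z b d) y - partialD b (fun z => N z c * Q z c d) y)
        + ∑ c, ∑ e, (regularConnection w Q H N y c c e * (N y e * Q y b d)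
          + N y c * Q y c e * regularConnection w Q H N y e b d
          + w y * (N y c * Q y c e * (N y e * Q y b d))
          - (regularConnection w Q H N y c b e * (N y e * Q y c d)
            + N y c * Q y b e * regularConnection w Q H N y e c d
            + w y * (N y c * Q y b e * (N y e * Q y c d)))))
      - (partialD b σ y + ∑ e, secondOrderDefect w Q N σ y b e * N y e) * partialD d w y
      + ((-1 + w y ^ 2 * σ y) * secondOrderDefect w Q N σ y b d
        - partialD b w y * ∑ c, N y c * secondOrderDefect w Q N σ y c d), ?_, ?_, ?_⟩
  · fun_prop (disch := assumption)
  · intro d b; fun_prop (disch := assumption)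
  have hK : ∀ᶠ y in 𝓝[interior R] y₀, ∀ k i j,
      DifferentiableAt ℝ (fun z => regularConnection w Q H N z k i j) y :=
    eventually_all.2 fun k => eventually_all.2 fun i => eventually_all.2 fun j =>
      (h7 k i j).eventually_differentiableAt h2
  have hNQ : ∀ᶠ y in 𝓝[interior R] y₀, ∀ k i j,
      DifferentiableAt ℝ (fun z => N z k * Q z i j) y :=
    eventually_all.2 fun k => eventually_all.2 fun i => eventually_all.2 fun j =>
      ((h4 k).mul (h8 i j)).eventually_differentiableAt h2
  have hΓ : ∀ᶠ y in 𝓝[interior R] y₀,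
      christoffel (fun z => (w z)⁻¹ ^ 2 • cylinderMetric w Q z) y
        = fun k i j => (regularConnection w Q H N y k i j + w y * (N y k * Q y i j))
          + ((1 : Matrix (Fin 4) (Fin 4) ℝ) k i * (-(w y)⁻¹ * partialD j w y)
            + (1 : Matrix (Fin 4) (Fin 4) ℝ) k j * (-(w y)⁻¹ * partialD i w y)) :=
    h.christoffel_physicalMetric.mono fun y hy => by ext k i j; exact hy k i j
  filter_upwards [eventually_eventually_nhds_of_interior hΓ, hK, hNQ, hv,
    h.regularConnection_symm, h.Q_symm, h.riemann_cylinderMetric, h.dw_covariantD, h.dw_N, h.Q_N,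
    h.w_ne_zero, h.dw_regularConnection, h5.eventually_differentiableAt h2,
    h.eventually_differentiableAt_partialD, h5.eventually_partialD_comm h2]
    with y g1 g2 g3 g4 g5 g6 g7 g8 g9 g10 g11 g12 g13 g14 g15 d b
  have d1 := differentiableAt_inv_of_ne g13 g11
  have d2 : DifferentiableAt ℝ (fun z => -(w z)⁻¹) y := d1.neg
  have d3 : ∀ k i j, DifferentiableAt ℝ (fun z => w z * (N z k * Q z i j)) y :=
    fun k i j => g13.mul (g3 k i j)
  have d4 : ∀ i, DifferentiableAt ℝ (fun z => -(w z)⁻¹ * partialD i w z) y :=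
    fun i => d2.mul (g14 i)
  have hψ : ∀ i j, partialD i (fun z => -(w z)⁻¹ * partialD j w z) y
      = (w y)⁻¹ ^ 2 * (partialD i w y * partialD j w y)
        - (w y)⁻¹ * partialD i (partialD j w) y := by
    intro i j
    have : partialD i (fun z => -(w z)⁻¹) y = (w y)⁻¹ ^ 2 * partialD i w y := by
      have := partialD_inv (k := i) g13 g11
      simp only [partialD] at this ⊢
      rw [fderiv_fun_neg, neg_apply, this]; ring
    rw [partialD_mul d2 (g14 j), this]; ring
  -- Here `3 (∇ψ - ψ ⊗ ψ)` is evaluated for `ψ = -dw/w` and the connection `K + w N ⊗ Q`: the `w⁻²`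
  -- terms cancel, as do the second derivatives of `w`.
  have vac : ∑ c, curvature (fun z k i j => regularConnection w Q H N z k i j
      + w z * (N z k * Q z i j)) y c d c b
      = 3 * ((-1 + w y ^ 2 * σ y) * Q y b d + w y * secondOrderDefect w Q N σ y b d) := by
    have t1 : ∑ c, curvature (christoffel (fun z => (w z)⁻¹ ^ 2 • cylinderMetric w Q z))
      y c d c b = 0 := g4 d b
    rw [curvature_congr g1] at t1
    have t2 := sum_curvature_projective (ψ := fun i z => -(w z)⁻¹ * partialD i w z)
      (K := fun z k i j => regularConnection w Q H N z k i j + w z * (N z k * Q z i j))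
      (fun k i j => (g2 k i j).add (d3 k i j)) (fun k i j => by simp only [g5 k i j, g6 i j]) d4
      (fun i j => by simp only [hψ, g15 i j]; ring) d b
    have t3 := t2.symm.trans t1
    rw [hψ] at t3
    have t4 := g12 b d
    have e1 : (w y)⁻¹ * w y ^ 2 = w y := by field_simp
    have e2 : (w y)⁻¹ * w y = 1 := by field_simp
    generalize ∑ c, curvature (fun z k i j => regularConnection w Q H N z k i j
      + w z * (N z k * Q z i j)) y c d c b = S at *
    simp only [Fin.sum_univ_four] at *
    linear_combination t3 + 3 * (w y)⁻¹ * t4 + 3 * secondOrderDefect w Q N σ y b d * e1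
      + 3 * (w y)⁻¹ * w y * Q y b d * g9 + 3 * (-1 + w y ^ 2 * σ y) * Q y b d * e2
  -- The only terms without a factor `w` come from differentiating `w` itself, namely `(dw · N) Q -
  -- dw ⊗ Q N` with `Q N = σ dw`.
  have hKQ : ∑ c, curvature (fun z k i j => regularConnection w Q H N z k i j
      + w z * (N z k * Q z i j)) y c d c b
      = ∑ c, curvature (regularConnection w Q H N) y c d c b
        + (-1 + w y ^ 2 * σ y) * Q y b d - σ y * (partialD b w y * partialD d w y)
        + w y * (∑ c, (partialD c (fun z => N z c * Q z b d) y
            - partialD b (fun z => N z c * Q z c d) y)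
          + ∑ c, ∑ e, (regularConnection w Q H N y c c e * (N y e * Q y b d)
          + N y c * Q y c e * regularConnection w Q H N y e b d
          + w y * (N y c * Q y c e * (N y e * Q y b d))
          - (regularConnection w Q H N y c b e * (N y e * Q y c d)
            + N y c * Q y b e * regularConnection w Q H N y e c d
            + w y * (N y c * Q y b e * (N y e * Q y c d))))) := by
    have t1 := g10 d
    simp only [curvature, partialD_add (g2 _ _ _) (d3 _ _ _), partialD_mul g13 (g3 _ _ _)]
    simp only [g6 d] at t1
    clear g1 g2 g3 g4 g5 g6 g7 g8 g10 g12 g14 g15 d3 d4 hψ vac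
    simp only [Fin.sum_univ_four] at *
    linear_combination Q y b d * g9 - partialD b w y * t1
  have hR : ricci (cylinderMetric w Q) y d b = ∑ c, riemann (cylinderMetric w Q) y c d c b := rfl
  rw [hR, g6 d b]
  simp only [g7]
  have t5 := g8 b
  have e1 : (w y)⁻¹ * w y = 1 := by field_simp
  generalize ∑ c, ∑ e, (regularConnection w Q H N y c c e * (N y e * Q y b d)
          + N y c * Q y c e * regularConnection w Q H N y e b d
          + w y * (N y c * Q y c e * (N y e * Q y b d))
          - (regularConnection w Q H N y c b e * (N y e * Q y c d)
            + N y c * Q y b e * regularConnection w Q H N y e c d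
            + w y * (N y c * Q y b e * (N y e * Q y c d)))) = S1 at *
  generalize ∑ e, secondOrderDefect w Q N σ y b e * N y e = S2 at *
  have vac' := hKQ.symm.trans vac
  clear g1 g2 g3 g4 g5 g6 g7 g8 g10 g12 g14 g15 d3 d4 hψ vac hKQ
  simp only [Fin.sum_univ_four] at *
  linear_combination vac' - (w y)⁻¹ * partialD d w y * t5
    + w y * secondOrderDefect w Q N σ y b d * g9
    + (-σ y * (partialD b w y * partialD d w y) - w y * (partialD b σ y + S2) * partialD d w y) * e1

end AsymptoteData

/-! ### The Weyl tensor and its electric and magnetic parts. -/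

theorem weyl_congr {G G' : EuclideanSpace ℝ (Fin 4) → Matrix (Fin 4) (Fin 4) ℝ}
    {y : EuclideanSpace ℝ (Fin 4)} (h : G =ᶠ[𝓝 y] G') : weyl G y = weyl G' y := by
  ext c d a b
  simp only [weyl, schouten, ricciScalar, ricci, riemann_congr h, h.eq_of_nhds]

theorem electricPart_congr {G G' : EuclideanSpace ℝ (Fin 4) → Matrix (Fin 4) (Fin 4) ℝ}
    {w : EuclideanSpace ℝ (Fin 4) → ℝ} {y : EuclideanSpace ℝ (Fin 4)} (h : G =ᶠ[𝓝 y] G') :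
    electricPart G w y = electricPart G' w y := by
  ext a b
  simp only [electricPart, weyl_congr h, h.eq_of_nhds]

theorem magneticPart_congr {G G' : EuclideanSpace ℝ (Fin 4) → Matrix (Fin 4) (Fin 4) ℝ}
    {w : EuclideanSpace ℝ (Fin 4) → ℝ} {y : EuclideanSpace ℝ (Fin 4)} (h : G =ᶠ[𝓝 y] G') :
    magneticPart G w y = magneticPart G' w y := by
  ext a b
  simp only [magneticPart, weylDual, weyl_congr h, h.eq_of_nhds]

/-- Contraction of a Kulkarni-Nomizu product twice with a vector. -/
theorem sum_kulkarniNomizu_contract (G : Matrix (Fin 4) (Fin 4) ℝ) (L : Fin 4 → Fin 4 → ℝ)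
    (N : Fin 4 → ℝ) (a b : Fin 4) :
    ∑ c, ∑ d, (G a b * L d c - G a d * L b c - G c b * L d a + G c d * L b a) * N c * N d
      = G a b * ∑ c, (∑ d, L d c * N d) * N c - (∑ d, G a d * N d) * (∑ c, L b c * N c)
        - (∑ c, G c b * N c) * (∑ d, L d a * N d)
        + (∑ c, (∑ d, G c d * N d) * N c) * L b a := by
  simp only [Fin.sum_univ_four]; ring

/-- Raising two indices of the decomposition of the curvature into its Weyl and Schouten parts. -/
theorem sum_raise_weyl {G H : Matrix (Fin 4) (Fin 4) ℝ} (hHG : H * G = 1)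
    (T : Fin 4 → Fin 4 → ℝ) (L L' : Fin 4 → ℝ) (p r b d : Fin 4) :
    ∑ e, ∑ f, H p e * H r f * (∑ k, G e k * T k f
        - (G e b * L f - G e d * L' f - G f b * L e + G f d * L' e))
      = ∑ f, H r f * T p f
        - ((1 : Matrix (Fin 4) (Fin 4) ℝ) p b * ∑ f, H r f * L f
          - (1 : Matrix (Fin 4) (Fin 4) ℝ) p d * ∑ f, H r f * L' f
          - (1 : Matrix (Fin 4) (Fin 4) ℝ) r b * ∑ f, H p f * L f
          + (1 : Matrix (Fin 4) (Fin 4) ℝ) r d * ∑ f, H p f * L' f) := by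
  have h1 : ∀ i j, (1 : Matrix (Fin 4) (Fin 4) ℝ) i j = ∑ k, H i k * G k j := by
    intro i j; rw [← hHG, Matrix.mul_apply]
  have h2 : ∀ f, T p f = ∑ e, H p e * ∑ k, G e k * T k f := by
    intro f
    have : ∑ k, (1 : Matrix (Fin 4) (Fin 4) ℝ) p k * T k f = T p f := by
      simp [Matrix.one_apply]
    rw [← this]
    simp only [h1, Finset.sum_mul, Finset.mul_sum]
    rw [Finset.sum_comm]
    exact Finset.sum_congr rfl fun _ _ => Finset.sum_congr rfl fun _ _ => by ring
  simp only [h1]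
  simp only [Fin.sum_univ_four] at h2 ⊢
  rw [h2 0, h2 1, h2 2, h2 3]
  ring

namespace AsymptoteData

variable {R : Set (EuclideanSpace ℝ (Fin 4))} {y₀ : EuclideanSpace ℝ (Fin 4)}
    {w : EuclideanSpace ℝ (Fin 4) → ℝ}
    {Q H : EuclideanSpace ℝ (Fin 4) → Matrix (Fin 4) (Fin 4) ℝ}
    {N : EuclideanSpace ℝ (Fin 4) → Fin 4 → ℝ} {σ : EuclideanSpace ℝ (Fin 4) → ℝ}

/-- The trace of `Q` with `H` is `3 + w² σ` and that of `dw ⊗ dw` is `O(w²)`, so the scalar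
curvature is `-6 + O(w)`. The `w⁻²` term of the Schouten tensor is the one of `G`. -/
theorem exists_schouten (h : AsymptoteData R y₀ w Q H N σ)
    (hv : ∀ᶠ y in 𝓝[interior R] y₀, ∀ d b,
      ricci (fun z => (w z)⁻¹ ^ 2 • cylinderMetric w Q z) y d b = 0) :
    ∃ (s : EuclideanSpace ℝ (Fin 4) → ℝ) (M : Fin 4 → Fin 4 → EuclideanSpace ℝ (Fin 4) → ℝ),
      ExtendsSmoothly R y₀ s ∧ (∀ i j, ExtendsSmoothly R y₀ (M i j)) ∧
      ∀ᶠ y in 𝓝[interior R] y₀, ∀ a b, schouten (cylinderMetric w Q) y a b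
        = -(1 / 2) * Q y a b
          + (-(1 / 2) * (w y)⁻¹ ^ 2 + (w y)⁻¹ * s y) * (partialD a w y * partialD b w y)
          + w y * M a b y := by
  obtain ⟨θ, M, hθ, hM, hric⟩ := h.exists_ricci hv
  have h3 := h.σ_smooth
  have h5 := h.w_smooth
  have h8 := h.Q_smooth
  have h9 := h.H_smooth
  set r : EuclideanSpace ℝ (Fin 4) → ℝ := fun y => -2 * w y * σ y + θ y * (-1 + w y ^ 2 * σ y)
    + ∑ a, ∑ b, H y a b * M a b y with hr
  refine ⟨fun y => (1 / 2) * (θ y + (1 / 6) * r y),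
    fun a b y => (1 / 2) * M a b y - (1 / 12) * r y * Q y a b, ?_, ?_, ?_⟩
  · fun_prop (disch := assumption)
  · intro a b; fun_prop (disch := assumption)
  filter_upwards [hric, h.w_ne_zero, h.inv_cylinderMetric, h.H_mul, h.Q_symm, h.H_dw, h.dw_N]
    with y g1 g2 g3 g4 g5 g6 g7 a b
  have e1 : (w y)⁻¹ * w y = 1 := by field_simp
  have e2 : (w y)⁻¹ ^ 2 * w y ^ 2 = 1 := by field_simp
  have e3 : (w y)⁻¹ * w y ^ 2 = w y := by field_simp
  have hww : ∑ a, ∑ b, H y a b * (partialD a w y * partialD b w y)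
      = w y ^ 2 * (-1 + w y ^ 2 * σ y) := by
    have : ∀ a, ∑ b, H y a b * (partialD a w y * partialD b w y)
        = partialD a w y * (w y ^ 2 * N y a) := by
      intro a
      rw [← g6 a, Finset.mul_sum]
      exact Finset.sum_congr rfl fun _ _ => by ring
    simp only [this]
    rw [← g7, Finset.mul_sum]
    exact Finset.sum_congr rfl fun _ _ => by ring
  have hG : ∑ a, ∑ b, H y a b * cylinderMetric w Q y b a = 4 := by
    have : ∀ a, ∑ b, H y a b * cylinderMetric w Q y b a = 1 := by
      intro a
      rw [← Matrix.mul_apply, g4, Matrix.one_apply_eq]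
    simp [this]
  have hQ : ∑ a, ∑ b, H y a b * Q y a b = 4 + (-1 + w y ^ 2 * σ y) := by
    have : ∀ a b, H y a b * Q y a b = H y a b * cylinderMetric w Q y b a
        + (w y)⁻¹ ^ 2 * (H y a b * (partialD a w y * partialD b w y)) := by
      intro a b
      simp only [cylinderMetric, Matrix.of_apply, g5 a b]; ring
    simp only [this, Finset.sum_add_distrib, ← Finset.mul_sum, hG, hww]
    linear_combination (-1 + w y ^ 2 * σ y) * e2
  have hR : ricciScalar (cylinderMetric w Q) y = -6 + w y * r y := by
    have : ∀ a b, H y a b * (-2 * Q y a b + (w y)⁻¹ * θ y * (partialD a w y * partialD b w y)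
        + w y * M a b y) = -2 * (H y a b * Q y a b) + (w y)⁻¹ * θ y *
          (H y a b * (partialD a w y * partialD b w y)) + w y * (H y a b * M a b y) := by
      intro a b; ring
    simp only [ricciScalar, g3, g1, this, Finset.sum_add_distrib, ← Finset.mul_sum, hQ, hww, hr]
    linear_combination θ y * (-1 + w y ^ 2 * σ y) * e3
  simp only [schouten, hR, g1, cylinderMetric, Matrix.of_apply]
  linear_combination (1 / 12) * (w y)⁻¹ * (partialD a w y * partialD b w y) * r y * e1

theorem cylinderMetric_N (h : AsymptoteData R y₀ w Q H N σ) :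
    ∀ᶠ y in 𝓝[interior R] y₀, ∀ a, w y ^ 2 * ∑ d, cylinderMetric w Q y a d * N y d
      = partialD a w y := by
  filter_upwards [h.Q_N, h.dw_N, h.w_ne_zero] with y h1 h2 h3 a
  have e2 : w y ^ 2 * (w y)⁻¹ ^ 2 = 1 := by field_simp
  have k := h1 a
  simp only [cylinderMetric, Matrix.of_apply, Fin.sum_univ_four] at *
  linear_combination w y ^ 2 * k - w y ^ 2 * (w y)⁻¹ ^ 2 * partialD a w y * h2
    - partialD a w y * (-1 + w y ^ 2 * σ y) * e2

/-- Lowering the index of `R` with `w² G = w² Q - dw ⊗ dw` costs nothing: `w R` is smooth and `dw ·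
R = O(w)`. In the Schouten part, both the `Q` terms and the `w⁻² dw ⊗ dw` terms cancel at leading
order. -/
theorem exists_electric (h : AsymptoteData R y₀ w Q H N σ)
    (hv : ∀ᶠ y in 𝓝[interior R] y₀, ∀ d b,
      ricci (fun z => (w z)⁻¹ ^ 2 • cylinderMetric w Q z) y d b = 0) :
    ∃ X : Fin 4 → Fin 4 → EuclideanSpace ℝ (Fin 4) → ℝ,
      (∀ a b, ExtendsSmoothly R y₀ (X a b)) ∧
      ∀ᶠ y in 𝓝[interior R] y₀, ∀ a b,
        w y ^ 2 * ∑ c, ∑ d, weyl (cylinderMetric w Q) y a c b d * N y c * N y d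
          = w y * X a b y := by
  obtain ⟨s, M, hs, hM, hsch⟩ := h.exists_schouten hv
  obtain ⟨Z, _, Y, hZ, -, hY, hriem⟩ := h.exists_riemann_bounds
  have h1 := h.uniqueDiffOn
  have h2 := h.mem
  have h3 := h.σ_smooth
  have h4 := h.N_smooth
  have h5 := h.w_smooth
  have h8 := h.Q_smooth
  refine ⟨fun a b y => ∑ c, ∑ d, (∑ e, Q y a e * Z e c b d y - partialD a w y * Y c b d y)
      * N y c * N y d
    - (Q y a b * (-w y * σ y * (-1 + w y ^ 2 * σ y) + s y * (-1 + w y ^ 2 * σ y) ^ 2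
        + w y ^ 2 * ∑ c, (∑ d, M d c y * N y d) * N y c)
      + partialD a w y * partialD b w y * (w y * σ y ^ 2 - s y * σ y * (-1 + w y ^ 2 * σ y)
        - ∑ c, (∑ d, M d c y * N y d) * N y c)
      - partialD a w y * ∑ c, M b c y * N y c - partialD b w y * ∑ d, M d a y * N y d
      + (-1 + w y ^ 2 * σ y) * M b a y), ?_, ?_⟩
  · intro a b; fun_prop (disch := assumption)
  filter_upwards [hsch, hriem, h.w_ne_zero, h.Q_symm, h.Q_N, h.dw_N, h.cylinderMetric_N]
    with y g1 g2 g3 g4 g5 g6 g7 a b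
  obtain ⟨r1, r2, -⟩ := g2
  have e2 : w y ^ 2 * (w y)⁻¹ ^ 2 = 1 := by field_simp
  have hR : ∀ c d, w y ^ 2 * ∑ e, cylinderMetric w Q y a e * riemann (cylinderMetric w Q) y e c b d
      = w y * (∑ e, Q y a e * Z e c b d y - partialD a w y * Y c b d y) := by
    intro c d
    have k := r2 c b d
    simp only [← r1]
    simp only [cylinderMetric, Matrix.of_apply, Fin.sum_univ_four] at *
    linear_combination - w y ^ 2 * (w y)⁻¹ ^ 2 * partialD a w y * k
      - partialD a w y * w y * Y c b d y * e2
  have hsplit : w y ^ 2 * ∑ c, ∑ d, weyl (cylinderMetric w Q) y a c b d * N y c * N y d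
      = w y * (∑ c, ∑ d, (∑ e, Q y a e * Z e c b d y - partialD a w y * Y c b d y)
          * N y c * N y d)
        - w y ^ 2 * ∑ c, ∑ d, (cylinderMetric w Q y a b * schouten (cylinderMetric w Q) y d c
          - cylinderMetric w Q y a d * schouten (cylinderMetric w Q) y b c
          - cylinderMetric w Q y c b * schouten (cylinderMetric w Q) y d a
          + cylinderMetric w Q y c d * schouten (cylinderMetric w Q) y b a) * N y c * N y d := by
    simp only [Finset.mul_sum, ← Finset.sum_sub_distrib]
    refine Finset.sum_congr rfl fun c _ => Finset.sum_congr rfl fun d _ => ?_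
    have k := hR c d
    simp only [weyl]
    linear_combination N y c * N y d * k
  have hGs : ∑ c, cylinderMetric w Q y c b * N y c = ∑ c, cylinderMetric w Q y b c * N y c :=
    Finset.sum_congr rfl fun c _ => by simp only [cylinderMetric, Matrix.of_apply, g4 c b]; ring
  have hL1 : ∑ c, schouten (cylinderMetric w Q) y b c * N y c
      = (-(1 / 2) * σ y + (-(1 / 2) * (w y)⁻¹ ^ 2 + (w y)⁻¹ * s y) * (-1 + w y ^ 2 * σ y))
        * partialD b w y + w y * ∑ c, M b c y * N y c := by
    have k := g5 b
    simp only [g1, Fin.sum_univ_four] at *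
    linear_combination -(1 / 2) * k
      + (-(1 / 2) * (w y)⁻¹ ^ 2 + (w y)⁻¹ * s y) * partialD b w y * g6
  have hL2 : ∀ a, ∑ d, schouten (cylinderMetric w Q) y d a * N y d
      = (-(1 / 2) * σ y + (-(1 / 2) * (w y)⁻¹ ^ 2 + (w y)⁻¹ * s y) * (-1 + w y ^ 2 * σ y))
        * partialD a w y + w y * ∑ d, M d a y * N y d := by
    intro a
    have k := g5 a
    simp only [g1, fun d => g4 d a, Fin.sum_univ_four] at *
    linear_combination -(1 / 2) * k
      + (-(1 / 2) * (w y)⁻¹ ^ 2 + (w y)⁻¹ * s y) * partialD a w y * g6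
  have hL3 : ∑ c, (∑ d, schouten (cylinderMetric w Q) y d c * N y d) * N y c
      = (-(1 / 2) * σ y + (-(1 / 2) * (w y)⁻¹ ^ 2 + (w y)⁻¹ * s y) * (-1 + w y ^ 2 * σ y))
        * (-1 + w y ^ 2 * σ y) + w y * ∑ c, (∑ d, M d c y * N y d) * N y c := by
    simp only [hL2]
    rw [← g6]
    simp only [Finset.mul_sum, Finset.sum_mul, ← Finset.sum_add_distrib]
    refine Finset.sum_congr rfl fun c _ => ?_
    rw [add_mul, Finset.sum_mul]
    simp only [mul_assoc]
  have hN2 : w y ^ 2 * ∑ c, (∑ d, cylinderMetric w Q y c d * N y d) * N y c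
      = -1 + w y ^ 2 * σ y := by
    rw [← g6, Finset.mul_sum]
    exact Finset.sum_congr rfl fun c _ => by rw [← mul_assoc, g7 c]
  rw [hsplit, sum_kulkarniNomizu_contract (cylinderMetric w Q y)
    (schouten (cylinderMetric w Q) y) (N y) a b, hGs, hL1, hL2, hL3, g1 b a]
  have na := g7 a
  have nb := g7 b
  have hGab : cylinderMetric w Q y a b
      = Q y a b - (w y)⁻¹ ^ 2 * (partialD a w y * partialD b w y) := rfl
  rw [hGab, g4 b a]
  generalize ∑ c, (∑ d, cylinderMetric w Q y c d * N y d) * N y c = t1 at *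
  generalize ∑ d, cylinderMetric w Q y a d * N y d = t2 at *
  generalize ∑ d, cylinderMetric w Q y b d * N y d = t3 at *
  generalize ∑ c, (∑ d, M d c y * N y d) * N y c = t4 at *
  generalize ∑ d, M d a y * N y d = t5 at *
  generalize ∑ d, M b d y * N y d = t6 at *
  generalize ∑ c, ∑ d, (∑ e, Q y a e * Z e c b d y - partialD a w y * Y c b d y)
      * N y c * N y d = t7 at *
  generalize Q y a b = qab at *
  generalize M b a y = mba at *
  clear hL3 hL2 hL1 hsplit hR r1 r2 g1 g4 g5 g6 g7 hGs hGab hsch hriem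
  generalize w y = u at *
  generalize partialD a w y = α at *
  generalize partialD b w y = β at *
  generalize σ y = ς at *
  generalize s y = τ at *
  -- The contractions of `G` with `N` are replaced by their values in terms of `dw`; what is left is
  -- a rational identity in which all poles cancel.
  have t1e : t1 = (-1 + u ^ 2 * ς) / u ^ 2 := by field_simp; linarith
  have t2e : t2 = α / u ^ 2 := by field_simp; linarith
  have t3e : t3 = β / u ^ 2 := by field_simp; linarith
  rw [t1e, t2e, t3e]
  field_simp
  ring

theorem tendsto_dw_N (h : AsymptoteData R y₀ w Q H N σ) :
    Tendsto (fun y => 1 - w y ^ 2 * σ y) (𝓝[interior R] y₀) (𝓝 1) := by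
  have h1 : Tendsto (fun y => w y * (w y * σ y)) (𝓝[interior R] y₀) (𝓝 0) :=
    (h.w_smooth.mul h.σ_smooth).tendsto_mul_zero h.w_tendsto
  have h2 := h1.const_sub 1
  rw [sub_zero] at h2
  exact h2.congr fun y => by ring

theorem covectorSq_cylinderMetric (h : AsymptoteData R y₀ w Q H N σ) :
    ∀ᶠ y in 𝓝[interior R] y₀, covectorSq (cylinderMetric w Q y) (fun k => partialD k w y)
      = -(w y ^ 2 * (1 - w y ^ 2 * σ y)) := by
  filter_upwards [h.inv_cylinderMetric, h.H_dw, h.dw_N] with y h1 h2 h3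
  have : ∀ a, ∑ b, H y a b * partialD a w y * partialD b w y
      = w y ^ 2 * (partialD a w y * N y a) := by
    intro a
    have k := h2 a
    simp only [Fin.sum_univ_four] at *
    linear_combination partialD a w y * k
  simp only [covectorSq, h1, this, ← Finset.mul_sum, h3]
  ring

theorem covectorSq_neg (h : AsymptoteData R y₀ w Q H N σ) :
    ∀ᶠ y in 𝓝[interior R] y₀,
      covectorSq (cylinderMetric w Q y) (fun k => partialD k w y) < 0 := by
  filter_upwards [h.covectorSq_cylinderMetric, h.tendsto_dw_N.eventually_const_lt one_pos,
    h.w_ne_zero] with y h1 h2 h3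
  rw [h1]
  have : 0 < w y ^ 2 := by positivity
  nlinarith [mul_pos this h2]

/-- Both parts of the Weyl tensor are quadratic in the normal, and in the product the square root,
hence also the sign of `w`, disappears. -/
theorem unitNormal_mul_unitNormal (h : AsymptoteData R y₀ w Q H N σ) :
    ∀ᶠ y in 𝓝[interior R] y₀, ∀ c d,
      unitNormal (cylinderMetric w Q y) (fun k => partialD k w y) c
        * unitNormal (cylinderMetric w Q y) (fun k => partialD k w y) d
        = w y ^ 2 * N y c * N y d / (1 - w y ^ 2 * σ y) := by
  filter_upwards [h.covectorSq_cylinderMetric, h.tendsto_dw_N.eventually_const_lt one_pos,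
    h.w_ne_zero, h.inv_cylinderMetric, h.H_dw] with y h1 h2 h3 h4 h5 c d
  have h6 : 0 < w y ^ 2 := by positivity
  have h7 := mul_pos h6 h2
  simp only [unitNormal, h1, h4, h5, abs_neg, abs_of_pos h7]
  rw [div_mul_div_comm, Real.mul_self_sqrt h7.le]
  field_simp

theorem tendsto_electricPart (h : AsymptoteData R y₀ w Q H N σ)
    (hv : ∀ᶠ y in 𝓝[interior R] y₀, ∀ d b,
      ricci (fun z => (w z)⁻¹ ^ 2 • cylinderMetric w Q z) y d b = 0) (a b : Fin 4) :
    Tendsto (fun y => electricPart (cylinderMetric w Q) w y a b) (𝓝[interior R] y₀) (𝓝 0) := by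
  obtain ⟨X, hX, hXe⟩ := h.exists_electric hv
  have h1 := ((hX a b).tendsto_mul_zero h.w_tendsto).div h.tendsto_dw_N one_ne_zero
  rw [zero_div] at h1
  refine h1.congr' ?_
  filter_upwards [hXe, h.unitNormal_mul_unitNormal] with y h2 h3
  simp only [Pi.div_apply]
  rw [← h2 a b]
  simp only [electricPart, mul_assoc, h3, Finset.mul_sum, Finset.sum_div]
  exact Finset.sum_congr rfl fun c _ => Finset.sum_congr rfl fun d _ => by ring

/-- With both indices raised, `G` becomes the identity in the Schouten part, and each polar term of
the curvature or Schouten tensor has a `dw` slot contracted with `H`, which gains the missing power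
`w²`. -/
theorem exists_raised_weyl (h : AsymptoteData R y₀ w Q H N σ)
    (hv : ∀ᶠ y in 𝓝[interior R] y₀, ∀ d b,
      ricci (fun z => (w z)⁻¹ ^ 2 • cylinderMetric w Q z) y d b = 0) :
    ∃ D : Fin 4 → Fin 4 → Fin 4 → Fin 4 → EuclideanSpace ℝ (Fin 4) → ℝ,
      (∀ p r b d, ExtendsSmoothly R y₀ (D p r b d)) ∧
      ∀ᶠ y in 𝓝[interior R] y₀, ∀ p r b d,
        ∑ e, ∑ f, H y p e * H y r f * weyl (cylinderMetric w Q) y e f b d = D p r b d y := by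
  obtain ⟨s, M, hs, hM, hsch⟩ := h.exists_schouten hv
  obtain ⟨_, X, _, -, hX, -, hriem⟩ := h.exists_riemann_bounds
  have h1 := h.uniqueDiffOn
  have h2 := h.mem
  have h4 := h.N_smooth
  have h5 := h.w_smooth
  have h8 := h.Q_smooth
  have h9 := h.H_smooth
  let L : Fin 4 → Fin 4 → EuclideanSpace ℝ (Fin 4) → ℝ := fun x r y =>
    -(1 / 2) * ∑ f, H y r f * Q y x f + (-(1 / 2) + w y * s y) * (partialD x w y * N y r)
      + w y * ∑ f, H y r f * M x f y
  refine ⟨fun p r b d y => X r p b d y - ((1 : Matrix (Fin 4) (Fin 4) ℝ) p b * L d r y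
      - (1 : Matrix (Fin 4) (Fin 4) ℝ) p d * L b r y
      - (1 : Matrix (Fin 4) (Fin 4) ℝ) r b * L d p y
      + (1 : Matrix (Fin 4) (Fin 4) ℝ) r d * L b p y), ?_, ?_⟩
  · intro p r b d; fun_prop (disch := assumption)
  filter_upwards [hsch, hriem, h.H_mul, h.w_ne_zero, h.H_dw] with y g1 g2 g3 g4 g5 p r b d
  have hHL : ∀ x r, ∑ f, H y r f * schouten (cylinderMetric w Q) y x f = L x r y := by
    intro x r
    have e2 : w y ^ 2 * (w y)⁻¹ ^ 2 = 1 := by field_simp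
    have e3 : w y ^ 2 * (w y)⁻¹ = w y := by field_simp
    have k := g5 r
    simp only [L, g1, Fin.sum_univ_four] at *
    linear_combination (-(1 / 2) * (w y)⁻¹ ^ 2 + (w y)⁻¹ * s y) * partialD x w y * k
      - (1 / 2) * partialD x w y * N y r * e2 + s y * partialD x w y * N y r * e3
  have k := sum_raise_weyl g3 (fun k f => riemann (cylinderMetric w Q) y k f b d)
    (fun f => schouten (cylinderMetric w Q) y d f) (fun f => schouten (cylinderMetric w Q) y b f)
    p r b d
  simp only [hHL, g2.2.2] at k
  exact k

/-- `√|det G|` grows at most like `1/|w|`, the raised Weyl tensor is bounded, and `n ⊗ n` is of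
order `w²`; the product is `O(w)`. -/
theorem tendsto_magneticPart (h : AsymptoteData R y₀ w Q H N σ)
    (hv : ∀ᶠ y in 𝓝[interior R] y₀, ∀ d b,
      ricci (fun z => (w z)⁻¹ ^ 2 • cylinderMetric w Q z) y d b = 0)
    (hdet : ExtendsSmoothly R y₀ fun y => w y ^ 2 * (cylinderMetric w Q y).det) (a b : Fin 4) :
    Tendsto (fun y => magneticPart (cylinderMetric w Q) w y a b) (𝓝[interior R] y₀) (𝓝 0) := by
  obtain ⟨D, hD, hDe⟩ := h.exists_raised_weyl hv
  have h4 := h.N_smooth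
  let I : Fin 4 → Fin 4 → EuclideanSpace ℝ (Fin 4) → ℝ := fun c d y => (1 / 2) * (∑ p, ∑ r,
    ((1 : Matrix (Fin 4) (Fin 4) ℝ).submatrix ![a, c, p, r] id).det * D p r b d y)
  have hX : ExtendsSmoothly R y₀ fun y => ∑ c, ∑ d, I c d y * N y c * N y d := by
    fun_prop
  obtain ⟨x, hx⟩ := hX.exists_tendsto
  obtain ⟨δ, hδ⟩ := hdet.exists_tendsto
  have h1 := (((hδ.abs.sqrt.mul h.w_tendsto.abs).mul hx).div h.tendsto_dw_N one_ne_zero)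
  rw [abs_zero, mul_zero, zero_mul, zero_div] at h1
  refine h1.congr' ?_
  filter_upwards [hDe, h.unitNormal_mul_unitNormal, h.inv_cylinderMetric] with y h2 h3 h4
  have hroot : Real.sqrt |w y ^ 2 * (cylinderMetric w Q y).det| * |w y|
      = w y ^ 2 * Real.sqrt |(cylinderMetric w Q y).det| := by
    rw [abs_mul, Real.sqrt_mul (abs_nonneg _), abs_of_nonneg (sq_nonneg _), Real.sqrt_sq_eq_abs,
      ← sq_abs (w y)]
    ring
  have hdual : ∀ c d, weylDual (cylinderMetric w Q) y a c b d
      = Real.sqrt |(cylinderMetric w Q y).det| * I c d y := by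
    intro c d
    simp only [weylDual, ← h2, h4, volumeForm, I, Finset.mul_sum]
    exact Finset.sum_congr rfl fun _ _ => Finset.sum_congr rfl fun _ _ =>
      Finset.sum_congr rfl fun _ _ => Finset.sum_congr rfl fun _ _ => by ring
  have hterm : ∀ c d, weylDual (cylinderMetric w Q) y a c b d
      * unitNormal (cylinderMetric w Q y) (fun k => partialD k w y) c
      * unitNormal (cylinderMetric w Q y) (fun k => partialD k w y) d
      = w y ^ 2 * Real.sqrt |(cylinderMetric w Q y).det| * (I c d y * N y c * N y d)
        / (1 - w y ^ 2 * σ y) := by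
    intro c d
    rw [mul_assoc, h3, hdual]; ring
  simp only [Pi.div_apply]
  rw [hroot]
  simp only [magneticPart, hterm, ← Finset.sum_div, ← Finset.mul_sum]

end AsymptoteData

/-! ### Rank one perturbations of matrices, and smoothness of the inverse metric. -/

section RankOne

variable {n : ℕ} {A : Matrix (Fin n) (Fin n) ℝ} {α N : Fin n → ℝ} {μ : ℝ}

theorem inv_mulVec_eq_smul (hA : IsUnit A.det) (hN : A.mulVec N = μ • α) (hμ : μ ≠ 0) :
    A⁻¹.mulVec α = μ⁻¹ • N := by
  have h1 : A⁻¹.mulVec (A.mulVec N) = N := by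
    rw [Matrix.mulVec_mulVec, Matrix.nonsing_inv_mul _ hA, Matrix.one_mulVec]
  rw [hN, Matrix.mulVec_smul] at h1
  rw [← h1, smul_smul, inv_mul_cancel₀ hμ, one_smul]

/-- The inverse of a rank one perturbation of a symmetric matrix. -/
theorem add_vecMulVec_mul_eq_one (hA : IsUnit A.det) (hAs : A.transpose = A)
    (hN : A.mulVec N = μ • α) (hμ : μ ≠ 0) {k t : ℝ}
    (hk : t * μ⁻¹ + k * μ + k * t * (N ⬝ᵥ α) = 0) :
    (A⁻¹ + k • Matrix.vecMulVec N N) * (A + t • Matrix.vecMulVec α α) = 1 := by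
  have h1 := inv_mulVec_eq_smul hA hN hμ
  have h2 : Matrix.vecMul N A = μ • α := by rw [← hN, ← Matrix.vecMul_transpose, hAs]
  have h3 : Matrix.vecMulVec N N * Matrix.vecMulVec α α = (N ⬝ᵥ α) • Matrix.vecMulVec N α := by
    ext i j
    simp only [Matrix.mul_apply, Matrix.vecMulVec_apply, Matrix.smul_apply, smul_eq_mul,
      dotProduct, Finset.sum_mul]
    exact Finset.sum_congr rfl fun _ _ => by ring
  rw [add_mul, mul_add, mul_add, Matrix.nonsing_inv_mul _ hA, Matrix.mul_smul,
    Matrix.mul_vecMulVec, h1, Matrix.smul_mul, Matrix.vecMulVec_mul, h2, Matrix.smul_mul,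
    Matrix.mul_smul, h3]
  ext i j
  simp only [Matrix.add_apply, Matrix.smul_apply, Matrix.vecMulVec_apply, smul_eq_mul,
    Pi.smul_apply]
  linear_combination N i * α j * hk

theorem det_add_smul_vecMulVec (hA : IsUnit A.det) (hN : A.mulVec N = μ • α) (hμ : μ ≠ 0) (t : ℝ) :
    (A + t • Matrix.vecMulVec α α).det = A.det * (1 + t * (α ⬝ᵥ N) * μ⁻¹) := by
  have h1 := inv_mulVec_eq_smul hA hN hμ
  have h2 : t • Matrix.vecMulVec α α
      = Matrix.replicateCol Unit (t • α) * Matrix.replicateRow Unit α := by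
    rw [← Matrix.vecMulVec_eq, Matrix.smul_vecMulVec]
  rw [h2, Matrix.det_add_replicateCol_mul_replicateRow hA, Matrix.mul_assoc,
    ← Matrix.replicateCol_mulVec, Matrix.mulVec_smul, h1]
  congr 1
  simp [Matrix.mul_apply, dotProduct, Finset.mul_sum, Finset.sum_mul]
  exact Finset.sum_congr rfl fun _ _ => by ring

/-- Only the (0,0) entry changes, and the determinant is affine in it, with the minor as slope. -/
theorem det_sub_smul_of_zero {Q : Matrix (Fin (n + 1)) (Fin (n + 1)) ℝ} {α : Fin (n + 1) → ℝ}
    (hα : ∀ i : Fin n, α i.succ = 0) (c : ℝ) :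
    (Q + c • Matrix.vecMulVec α α).det
      = Q.det + c * α 0 ^ 2 * (Q.submatrix Fin.succ Fin.succ).det := by
  have h1 : ∀ j : Fin (n + 1), (Q + c • Matrix.vecMulVec α α).submatrix Fin.succ j.succAbove
      = Q.submatrix Fin.succ j.succAbove := by
    intro j
    ext a b
    simp [Matrix.vecMulVec_apply, hα]
  rw [Matrix.det_succ_row_zero, Matrix.det_succ_row_zero Q]
  simp only [h1]
  rw [Fin.sum_univ_succ, Fin.sum_univ_succ]
  simp [Matrix.vecMulVec_apply, hα]
  ring

end RankOne

section MatrixCalculus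

variable {m n : ℕ} {R : Set (EuclideanSpace ℝ (Fin n))} {y₀ : EuclideanSpace ℝ (Fin n)}
  {A : EuclideanSpace ℝ (Fin n) → Matrix (Fin m) (Fin m) ℝ}

theorem ExtendsSmoothly.det (hA : ∀ i j, ExtendsSmoothly R y₀ fun y => A y i j) :
    ExtendsSmoothly R y₀ fun y => (A y).det := by
  simp only [Matrix.det_apply']
  fun_prop

theorem ExtendsSmoothly.matrix_inv [NeBot (𝓝[interior R] y₀)]
    (hA : ∀ i j, ExtendsSmoothly R y₀ fun y => A y i j) {c : ℝ}
    (hc : Tendsto (fun y => (A y).det) (𝓝[interior R] y₀) (𝓝 c)) (hc0 : c ≠ 0) (i j : Fin m) :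
    ExtendsSmoothly R y₀ fun y => (A y)⁻¹ i j := by
  have h1 := (ExtendsSmoothly.det hA).inv hc hc0
  simp only [Matrix.inv_def, Ring.inverse_eq_inv', Matrix.smul_apply, smul_eq_mul,
    Matrix.adjugate_apply]
  refine h1.mul (ExtendsSmoothly.det fun a b => ?_)
  by_cases h : a = j
  · subst h
    simpa using ExtendsSmoothly.const _
  · simpa [Matrix.updateRow_ne h] using hA a b

end MatrixCalculus

/-- `Q` may degenerate at `y₀`, as only its restriction to the boundary directions is nondegenerate.
A fixed multiple of `dw ⊗ dw` is therefore subtracted to get an invertible `A`, and `G` is treated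
as a rank one perturbation of `A`. -/
theorem exists_asymptoteData {R : Set (EuclideanSpace ℝ (Fin 4))} {y₀ : EuclideanSpace ℝ (Fin 4)}
    [NeBot (𝓝[interior R] y₀)] {w : EuclideanSpace ℝ (Fin 4) → ℝ}
    {Q : EuclideanSpace ℝ (Fin 4) → Matrix (Fin 4) (Fin 4) ℝ}
    {N : EuclideanSpace ℝ (Fin 4) → Fin 4 → ℝ} (hR : UniqueDiffOn ℝ R) (hy₀ : y₀ ∈ R)
    (hw : ExtendsSmoothly R y₀ w) (hQ : ∀ i j, ExtendsSmoothly R y₀ fun y => Q y i j)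
    (hN : ∀ i, ExtendsSmoothly R y₀ fun y => N y i)
    (hw0 : Tendsto w (𝓝[interior R] y₀) (𝓝 0)) (hwne : ∀ᶠ y in 𝓝[interior R] y₀, w y ≠ 0)
    (hQs : ∀ᶠ y in 𝓝[interior R] y₀, ∀ i j, Q y i j = Q y j i)
    (hGN : ∀ᶠ y in 𝓝[interior R] y₀, ∀ i,
      w y ^ 2 * ∑ j, cylinderMetric w Q y i j * N y j = partialD i w y)
    {α : Fin 4 → ℝ} (hα : ∀ i, Tendsto (partialD i w) (𝓝[interior R] y₀) (𝓝 (α i)))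
    (hα0 : α 0 ≠ 0) (hα1 : ∀ i : Fin 3, α i.succ = 0) {Q₀ : Matrix (Fin 4) (Fin 4) ℝ}
    (hQ₀ : ∀ i j, Tendsto (fun y => Q y i j) (𝓝[interior R] y₀) (𝓝 (Q₀ i j)))
    (hdet : (Q₀.submatrix Fin.succ Fin.succ).det ≠ 0) :
    (∃ H σ, AsymptoteData R y₀ w Q H N σ) ∧
      ExtendsSmoothly R y₀ fun y => w y ^ 2 * (cylinderMetric w Q y).det := by
  have hdw : ∀ i, ExtendsSmoothly R y₀ (partialD i w) := hw.partialD hR hy₀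
  -- Dividing the component 0 of `Q N = σ dw` by `∂₀w`, which is nonzero at `y₀`, shows that `σ` is
  -- smooth although its other expression `w⁻² (1 + dw · N)` has an apparent pole.
  set σ : EuclideanSpace ℝ (Fin 4) → ℝ := fun y => (∑ j, Q y 0 j * N y j) * (partialD 0 w y)⁻¹
    with hσd
  have hσ : ExtendsSmoothly R y₀ σ :=
    (ExtendsSmoothly.sum fun j _ => (hQ 0 j).mul (hN j)).mul ((hdw 0).inv (hα 0) hα0)
  have hGN' : ∀ᶠ y in 𝓝[interior R] y₀, ∀ i, ∑ j, Q y i j * N y j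
      = (w y)⁻¹ ^ 2 * (1 + ∑ i, partialD i w y * N y i) * partialD i w y := by
    filter_upwards [hGN, hwne] with y h1 h2 i
    have e2 : w y ^ 2 * (w y)⁻¹ ^ 2 = 1 := by field_simp
    have k := h1 i
    simp only [cylinderMetric, Matrix.of_apply, Fin.sum_univ_four] at *
    linear_combination (w y)⁻¹ ^ 2 * k - (Q y i 0 * N y 0 + Q y i 1 * N y 1 + Q y i 2 * N y 2
      + Q y i 3 * N y 3 - (w y)⁻¹ ^ 2 * partialD i w y * (partialD 0 w y * N y 0
      + partialD 1 w y * N y 1 + partialD 2 w y * N y 2 + partialD 3 w y * N y 3)) * e2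
  have hσe : ∀ᶠ y in 𝓝[interior R] y₀,
      σ y = (w y)⁻¹ ^ 2 * (1 + ∑ i, partialD i w y * N y i) := by
    filter_upwards [hGN', (hα 0).eventually_ne hα0] with y h1 h2
    simp only [hσd, h1 0, mul_assoc, mul_inv_cancel₀ h2, mul_one]
  have hQN : ∀ᶠ y in 𝓝[interior R] y₀, ∀ i, ∑ j, Q y i j * N y j = σ y * partialD i w y := by
    filter_upwards [hGN', hσe] with y h1 h2 i
    rw [h1, h2]
  have hν : ∀ᶠ y in 𝓝[interior R] y₀, ∑ i, partialD i w y * N y i = -1 + w y ^ 2 * σ y := by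
    filter_upwards [hσe, hwne] with y h1 h2
    rw [h1]; field_simp; ring
  -- The determinant is affine in `c` with nonzero slope, so one of the values 0 and 1 works.
  obtain ⟨c, hc⟩ : ∃ c : ℝ, (Q₀ + (-c) • Matrix.vecMulVec α α).det ≠ 0 := by
    by_cases h0 : Q₀.det = 0
    · exact ⟨1, by rw [det_sub_smul_of_zero hα1, h0]; simp [hα0, hdet]⟩
    · exact ⟨0, by simpa using h0⟩
  set A : EuclideanSpace ℝ (Fin 4) → Matrix (Fin 4) (Fin 4) ℝ := fun y =>
    Q y + (-c) • Matrix.vecMulVec (fun i => partialD i w y) (fun i => partialD i w y) with hAd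
  have hAe : ∀ y i j, A y i j = Q y i j + -c * (partialD i w y * partialD j w y) :=
    fun y i j => rfl
  have hA : ∀ i j, ExtendsSmoothly R y₀ fun y => A y i j := by
    intro i j
    simp only [hAe]
    fun_prop
  have hA₀ : Tendsto A (𝓝[interior R] y₀) (𝓝 (Q₀ + (-c) • Matrix.vecMulVec α α)) := by
    refine tendsto_pi_nhds.2 fun i => tendsto_pi_nhds.2 fun j => ?_
    exact (hQ₀ i j).add (((hα i).mul (hα j)).const_mul (-c))
  have hAdet : Tendsto (fun y => (A y).det) (𝓝[interior R] y₀)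
      (𝓝 (Q₀ + (-c) • Matrix.vecMulVec α α).det) :=
    ((continuous_id.matrix_det).tendsto _).comp hA₀
  have hAu : ∀ᶠ y in 𝓝[interior R] y₀, IsUnit (A y).det :=
    (hAdet.eventually_ne hc).mono fun y hy => isUnit_iff_ne_zero.2 hy
  set μ : EuclideanSpace ℝ (Fin 4) → ℝ := fun y => σ y - c * ∑ i, partialD i w y * N y i with hμd
  have hμ : ExtendsSmoothly R y₀ μ := by
    rw [hμd]; fun_prop
  have hAN : ∀ᶠ y in 𝓝[interior R] y₀,
      (A y).mulVec (N y) = μ y • fun i => partialD i w y := by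
    filter_upwards [hQN] with y h1
    ext i
    have k := h1 i
    simp only [Matrix.mulVec, dotProduct, hAe, Pi.smul_apply, smul_eq_mul, hμd,
      Fin.sum_univ_four] at *
    linear_combination k
  obtain ⟨m, hm⟩ := hμ.exists_tendsto
  -- If `μ` tended to zero, the limit of `N` would lie in the kernel of the invertible limit of `A`
  -- and so vanish, against `dw · N → -1`.
  have hm0 : m ≠ 0 := by
    rintro rfl
    choose n hn using fun i => (hN i).exists_tendsto
    have h1 : Tendsto (fun y => (A y).mulVec (N y)) (𝓝[interior R] y₀)
        (𝓝 ((Q₀ + (-c) • Matrix.vecMulVec α α).mulVec n)) := by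
      rw [tendsto_pi_nhds]; intro i
      exact tendsto_finsetSum Finset.univ fun j _ =>
        ((tendsto_pi_nhds.1 (tendsto_pi_nhds.1 hA₀ i)) j).mul (hn j)
    have h2 : Tendsto (fun y => μ y • fun i => partialD i w y) (𝓝[interior R] y₀)
        (𝓝 ((0 : ℝ) • α)) := hm.smul (tendsto_pi_nhds.2 hα)
    have h3 := tendsto_nhds_unique (h1.congr' hAN) h2
    rw [zero_smul] at h3
    have h4 := Matrix.eq_zero_of_mulVec_eq_zero hc h3
    have h5 : Tendsto (fun y => ∑ i, partialD i w y * N y i) (𝓝[interior R] y₀)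
        (𝓝 (∑ i, α i * n i)) := tendsto_finsetSum _ fun i _ => (hα i).mul (hn i)
    have h6 : Tendsto (fun y => -1 + w y ^ 2 * σ y) (𝓝[interior R] y₀) (𝓝 (-1 + 0 ^ 2 * _)) :=
      ((hw0.pow 2).mul hσ.exists_tendsto.choose_spec).const_add (-1)
    have h7 := tendsto_nhds_unique (h5.congr' hν) h6
    simp [h4] at h7
  have hcyl : ∀ y, cylinderMetric w Q y = A y + (c - (w y)⁻¹ ^ 2) •
      Matrix.vecMulVec (fun i => partialD i w y) (fun i => partialD i w y) := by
    intro y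
    ext i j
    simp only [cylinderMetric, Matrix.of_apply, Matrix.add_apply, hAe, Matrix.smul_apply,
      Matrix.vecMulVec_apply, smul_eq_mul]
    ring
  have hμi := hμ.inv hm hm0
  have hAi := fun i j => ExtendsSmoothly.matrix_inv hA hAdet hc i j
  -- Sherman–Morrison for `G = A + (c - w⁻²) dw ⊗ dw` with `A⁻¹ dw = μ⁻¹ N`. The relation between
  -- `μ`, `σ` and `dw · N` clears the denominator, so the coefficient of `N ⊗ N` is smooth at `w =
  -- 0`.
  refine ⟨⟨fun y => (A y)⁻¹ + ((1 - c * w y ^ 2) * (μ y)⁻¹) • Matrix.vecMulVec (N y) (N y), σ, ?_⟩,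
    ?_⟩
  · refine ⟨hR, hy₀, hw, hQ, ?_, hN, hσ, hw0, hwne, hQs, ?_, ?_, hQN, hν⟩
    · intro i j
      simp only [Matrix.add_apply, Matrix.smul_apply, Matrix.vecMulVec_apply, smul_eq_mul]
      fun_prop
    · filter_upwards [hAu, hAN, hm.eventually_ne hm0, hν, hwne, hQs] with y h1 h2 h3 h4 h5 h6
      rw [hcyl]
      refine add_vecMulVec_mul_eq_one h1 ?_ h2 h3 ?_
      · ext i j
        simp only [Matrix.transpose_apply, hAe, h6 j i]; ring
      · have h7 : N y ⬝ᵥ (fun i => partialD i w y) = -1 + w y ^ 2 * σ y := by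
          rw [← h4]; exact Finset.sum_congr rfl fun _ _ => mul_comm _ _
        have h8 : μ y = σ y - c * (-1 + w y ^ 2 * σ y) := by simp only [hμd, h4]
        rw [h7]
        have h9 : σ y = μ y + c * (-1 + w y ^ 2 * σ y) := by rw [h8]; ring
        field_simp
        linear_combination (c * w y ^ 2 - 1) * w y ^ 2 * h9
    · filter_upwards [hAu, hAN, hm.eventually_ne hm0, hν] with y h1 h2 h3 h4 k
      have h5 := congrFun (inv_mulVec_eq_smul h1 h2 h3) k
      simp only [Matrix.mulVec, dotProduct, Pi.smul_apply, smul_eq_mul] at h5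
      have h8 : μ y = σ y - c * (-1 + w y ^ 2 * σ y) := by simp only [hμd, h4]
      have h9 : (μ y)⁻¹ * μ y = 1 := inv_mul_cancel₀ h3
      simp only [Matrix.add_apply, Matrix.smul_apply, Matrix.vecMulVec_apply, smul_eq_mul,
        Fin.sum_univ_four] at *
      linear_combination h5 + (1 - c * w y ^ 2) * (μ y)⁻¹ * N y k * h4 + w y ^ 2 * N y k * h9
        - w y ^ 2 * N y k * (μ y)⁻¹ * h8
  · have h1 : ExtendsSmoothly R y₀ fun y => (A y).det * (w y ^ 2 + (c * w y ^ 2 - 1)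
        * (∑ i, partialD i w y * N y i) * (μ y)⁻¹) := by
      have := ExtendsSmoothly.det hA
      fun_prop
    refine h1.congr ?_
    filter_upwards [hAu, hAN, hm.eventually_ne hm0, hwne] with y h1 h2 h3 h4
    rw [hcyl, det_add_smul_vecMulVec h1 h2 h3]
    simp only [dotProduct]
    field_simp

/-! Charts of manifolds with boundary. -/

section Charts

variable {M : Type*} [TopologicalSpace M] {e : OpenPartialHomeomorph M (EuclideanHalfSpace 4)}

theorem extend_target_mem_nhdsWithin_of_mem {y : EuclideanSpace ℝ (Fin 4)}
    (hy : y ∈ (e.extend (𝓡∂ 4)).target) :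
    (e.extend (𝓡∂ 4)).target ∈ 𝓝[range (𝓡∂ 4)] y := by
  have h1 := (e.extend (𝓡∂ 4)).map_target hy
  rw [e.extend_source] at h1
  simpa only [(e.extend (𝓡∂ 4)).right_inv hy] using e.extend_target_mem_nhdsWithin (I := 𝓡∂ 4) h1

theorem uniqueMDiffWithinAt_range {y : EuclideanSpace ℝ (Fin 4)}
    (hy : y ∈ (e.extend (𝓡∂ 4)).target) :
    UniqueMDiffWithinAt 𝓘(ℝ, EuclideanSpace ℝ (Fin 4)) (range (𝓡∂ 4)) y :=
  ((𝓡∂ 4).uniqueDiffOn y (e.extend_target_subset_range hy)).uniqueMDiffWithinAt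

variable [ChartedSpace (EuclideanHalfSpace 4) M]

theorem contMDiffWithinAt_extend_symm (he : e ∈ IsManifold.maximalAtlas (𝓡∂ 4) ∞ M)
    {y : EuclideanSpace ℝ (Fin 4)} (hy : y ∈ (e.extend (𝓡∂ 4)).target) :
    ContMDiffWithinAt 𝓘(ℝ, EuclideanSpace ℝ (Fin 4)) (𝓡∂ 4) ∞ (e.extend (𝓡∂ 4)).symm
      (range (𝓡∂ 4)) y := by
  have h1 := contMDiffOn_extend_symm he
  rw [← e.extend_target'] at h1
  exact (h1 y hy).mono_of_mem_nhdsWithin (extend_target_mem_nhdsWithin_of_mem hy)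

theorem mdifferentiableWithinAt_extend_symm (he : e ∈ IsManifold.maximalAtlas (𝓡∂ 4) ∞ M)
    {y : EuclideanSpace ℝ (Fin 4)} (hy : y ∈ (e.extend (𝓡∂ 4)).target) :
    MDifferentiableWithinAt 𝓘(ℝ, EuclideanSpace ℝ (Fin 4)) (𝓡∂ 4) (e.extend (𝓡∂ 4)).symm
      (range (𝓡∂ 4)) y :=
  (contMDiffWithinAt_extend_symm he hy).mdifferentiableWithinAt (by simp)

theorem mfderivWithin_extend_symm_comp_mfderiv_extend
    (he : e ∈ IsManifold.maximalAtlas (𝓡∂ 4) ∞ M)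
    {y : EuclideanSpace ℝ (Fin 4)} (hy : y ∈ (e.extend (𝓡∂ 4)).target) :
    ∀ v : TangentSpace (𝓡∂ 4) ((e.extend (𝓡∂ 4)).symm y), mfderivWithin 𝓘(ℝ, EuclideanSpace ℝ (Fin 4)) (𝓡∂ 4) (e.extend (𝓡∂ 4)).symm
      (range (𝓡∂ 4)) y (mfderiv (𝓡∂ 4) 𝓘(ℝ, EuclideanSpace ℝ (Fin 4)) (e.extend (𝓡∂ 4))
        ((e.extend (𝓡∂ 4)).symm y) v) = v := by
  set φ := e.extend (𝓡∂ 4) with hφ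
  have h1 : φ.symm y ∈ e.source := by
    rw [← e.extend_source (I := 𝓡∂ 4)]; exact φ.map_target hy
  have h2 : UniqueMDiffWithinAt (𝓡∂ 4) e.source (φ.symm y) :=
    e.open_source.uniqueMDiffWithinAt h1
  have h3 : MDifferentiableAt (𝓡∂ 4) 𝓘(ℝ, EuclideanSpace ℝ (Fin 4)) φ (φ.symm y) :=
    (e.contMDiffAt_extend he h1).mdifferentiableAt (by simp)
  have h4 := mfderivWithin_comp_of_eq (I := 𝓡∂ 4) (x := φ.symm y) (f := φ) (g := φ.symm)
    (s := e.source) (u := range (𝓡∂ 4)) (mdifferentiableWithinAt_extend_symm he hy)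
    h3.mdifferentiableWithinAt (fun z _ => by simp [hφ])
    h2 (φ.right_inv hy)
  have h5 : mfderivWithin (𝓡∂ 4) (𝓡∂ 4) (φ.symm ∘ φ) e.source (φ.symm y)
      = mfderivWithin (𝓡∂ 4) (𝓡∂ 4) id e.source (φ.symm y) := by
    apply mfderivWithin_congr
    · intro z hz
      exact e.extend_left_inv hz
    · simp only [Function.comp_apply, φ.right_inv hy, id]
  rw [h5, mfderivWithin_id h2, mfderivWithin_eq_mfderiv h2 h3] at h4
  exact fun v => (congrArg (fun L => L v) h4).symm

/-- Interior points are defined by the preferred chart at the point. Any chart of the maximal atlas,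
like its inverse, has surjective derivative and so maps interior points to interior points. -/
theorem isInteriorPoint_iff_extend_mem [IsManifold (𝓡∂ 4) ∞ M]
    (he : e ∈ IsManifold.maximalAtlas (𝓡∂ 4) ∞ M)
    {x : M} (hx : x ∈ e.source) :
    x ∈ (𝓡∂ 4).interior M ↔ e.extend (𝓡∂ 4) x ∈ interior (range (𝓡∂ 4)) := by
  have hd : e.MDifferentiable (𝓡∂ 4) (𝓡∂ 4) :=
    ⟨(contMDiffOn_of_mem_maximalAtlas he).mdifferentiableOn (by simp),
      (contMDiffOn_symm_of_mem_maximalAtlas he).mdifferentiableOn (by simp)⟩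
  have h1 : (𝓡∂ 4).IsInteriorPoint (e x) ↔ e.extend (𝓡∂ 4) x ∈ interior (range (𝓡∂ 4)) := by
    exact Iff.rfl
  rw [← h1]
  constructor
  · intro h
    exact (hd.mdifferentiableAt hx).isInteriorPoint_of_surjective_mfderiv
      (hd.mfderiv_surjective hx) h
  · intro h
    have h2 := (hd.symm.mdifferentiableAt (e.map_source hx)).isInteriorPoint_of_surjective_mfderiv
      (hd.symm.mfderiv_surjective (e.map_source hx)) h
    rwa [e.left_inv hx] at h2

theorem fderivWithin_comp_extend_symm (he : e ∈ IsManifold.maximalAtlas (𝓡∂ 4) ∞ M) {Ω : M → ℝ}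
    (hΩ : ContMDiff (𝓡∂ 4) 𝓘(ℝ, ℝ) ∞ Ω) {y : EuclideanSpace ℝ (Fin 4)}
    (hy : y ∈ (e.extend (𝓡∂ 4)).target) (u : EuclideanSpace ℝ (Fin 4)) :
    fderivWithin ℝ (fun z => Ω ((e.extend (𝓡∂ 4)).symm z)) (range (𝓡∂ 4)) y u
      = differential Ω ((e.extend (𝓡∂ 4)).symm y)
        (mfderivWithin 𝓘(ℝ, EuclideanSpace ℝ (Fin 4)) (𝓡∂ 4) (e.extend (𝓡∂ 4)).symm
          (range (𝓡∂ 4)) y u) := by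
  have h1 := mfderiv_comp_mfderivWithin (f := (e.extend (𝓡∂ 4)).symm) (g := Ω) y
    ((hΩ _).mdifferentiableAt (by simp)) (mdifferentiableWithinAt_extend_symm he hy)
    (uniqueMDiffWithinAt_range hy)
  rw [mfderivWithin_eq_fderivWithin] at h1
  exact congrArg (fun L => L u) h1

theorem contDiffWithinAt_comp_extend_symm (he : e ∈ IsManifold.maximalAtlas (𝓡∂ 4) ∞ M)
    {Ω : M → ℝ} (hΩ : ContMDiff (𝓡∂ 4) 𝓘(ℝ, ℝ) ∞ Ω) {y : EuclideanSpace ℝ (Fin 4)}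
    (hy : y ∈ (e.extend (𝓡∂ 4)).target) :
    ContDiffWithinAt ℝ ∞ (fun z => Ω ((e.extend (𝓡∂ 4)).symm z)) (range (𝓡∂ 4)) y :=
  ((hΩ _).comp_contMDiffWithinAt y (contMDiffWithinAt_extend_symm he hy)).contDiffWithinAt

theorem partialD_comp_extend_symm (he : e ∈ IsManifold.maximalAtlas (𝓡∂ 4) ∞ M) {Ω : M → ℝ}
    (hΩ : ContMDiff (𝓡∂ 4) 𝓘(ℝ, ℝ) ∞ Ω) {y : EuclideanSpace ℝ (Fin 4)}
    (hy : y ∈ (e.extend (𝓡∂ 4)).target) (hyi : y ∈ interior (range (𝓡∂ 4))) (k : Fin 4) :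
    partialD k (fun z => Ω ((e.extend (𝓡∂ 4)).symm z)) y
      = differential Ω ((e.extend (𝓡∂ 4)).symm y) (coordVec e y k) := by
  rw [partialD, ← fderivWithin_of_mem_nhds (mem_interior_iff_mem_nhds.1 hyi),
    fderivWithin_comp_extend_symm he hΩ hy]
  rfl

theorem sum_vectorComponents_smul_coordVec (he : e ∈ IsManifold.maximalAtlas (𝓡∂ 4) ∞ M)
    (N : ∀ x : M, TangentSpace (𝓡∂ 4) x) {y : EuclideanSpace ℝ (Fin 4)}
    (hy : y ∈ (e.extend (𝓡∂ 4)).target) :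
    ∑ i, vectorComponents e N y i • coordVec e y i = N ((e.extend (𝓡∂ 4)).symm y) := by
  have h1 : vectorComponents e N y
      = ∑ i, vectorComponents e N y i • EuclideanSpace.single i (1 : ℝ) := by
    ext j
    simp [Pi.single_apply]
  have h2 := mfderivWithin_extend_symm_comp_mfderiv_extend he hy (N ((e.extend (𝓡∂ 4)).symm y))
  change mfderivWithin 𝓘(ℝ, EuclideanSpace ℝ (Fin 4)) (𝓡∂ 4) (e.extend (𝓡∂ 4)).symm
      (range (𝓡∂ 4)) y (vectorComponents e N y) = _ at h2
  rw [← h2]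
  conv_rhs => rw [h1]
  erw [map_sum]
  refine Finset.sum_congr rfl fun i _ => ?_
  erw [map_smul]
  rfl

theorem HasLorentzSignature.transpose_eq {n : ℕ} {A : Matrix (Fin (n + 1)) (Fin (n + 1)) ℝ}
    (h : HasLorentzSignature A) : A.transpose = A := by
  obtain ⟨P, hP, hA⟩ := h
  have h1 : P.transpose * A.transpose * P = P.transpose * A * P := by
    have h2 := congrArg Matrix.transpose hA
    rw [Matrix.diagonal_transpose, Matrix.transpose_mul, Matrix.transpose_mul,
      Matrix.transpose_transpose, ← Matrix.mul_assoc] at h2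
    rw [h2, hA]
  have hP' : IsUnit P := (Matrix.isUnit_iff_isUnit_det P).2 hP
  have hPt : IsUnit P.transpose :=
    (Matrix.isUnit_iff_isUnit_det _).2 (by rwa [Matrix.det_transpose])
  exact hPt.mul_left_cancel (hP'.mul_right_cancel h1)

theorem HasLorentzSignature.det_ne_zero {n : ℕ} {A : Matrix (Fin (n + 1)) (Fin (n + 1)) ℝ}
    (h : HasLorentzSignature A) : A.det ≠ 0 := by
  obtain ⟨P, hP, hA⟩ := h
  intro h0
  have h1 := congrArg Matrix.det hA
  rw [Matrix.det_mul, Matrix.det_mul, h0, mul_zero, zero_mul, Matrix.det_diagonal] at h1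
  refine Finset.prod_ne_zero_iff.2 (fun i _ => ?_) h1.symm
  refine Fin.cases ?_ (fun j => ?_) i <;> simp

theorem tendsto_extend_interior [IsManifold (𝓡∂ 4) ∞ M]
    (he : e ∈ IsManifold.maximalAtlas (𝓡∂ 4) ∞ M) {p : M} (hp : p ∈ e.source) :
    Tendsto (e.extend (𝓡∂ 4)) (𝓝[(𝓡∂ 4).interior M] p)
      (𝓝[interior (range (𝓡∂ 4))] (e.extend (𝓡∂ 4) p)) := by
  refine tendsto_nhdsWithin_iff.2 ⟨(e.continuousAt_extend hp).continuousWithinAt.tendsto, ?_⟩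
  filter_upwards [nhdsWithin_le_nhds (e.open_source.mem_nhds hp), self_mem_nhdsWithin] with x h1 h2
  exact (isInteriorPoint_iff_extend_mem he h1).1 h2

theorem extend_zero_of_mem_boundary [IsManifold (𝓡∂ 4) ∞ M]
    (he : e ∈ IsManifold.maximalAtlas (𝓡∂ 4) ∞ M) {p : M} (hp : p ∈ e.source) :
    p ∈ (𝓡∂ 4).boundary M ↔ e.extend (𝓡∂ 4) p 0 = 0 := by
  have h1 : p ∈ (𝓡∂ 4).boundary M ↔ ¬ p ∈ (𝓡∂ 4).interior M :=
    (𝓡∂ 4).isBoundaryPoint_iff_not_isInteriorPoint p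
  have h2 : e.extend (𝓡∂ 4) p ∈ range (𝓡∂ 4) := e.extend_target_subset_range
    ((e.extend (𝓡∂ 4)).map_source (by rwa [e.extend_source]))
  rw [range_modelWithCornersEuclideanHalfSpace] at h2
  rw [h1, isInteriorPoint_iff_extend_mem he hp, interior_range_modelWithCornersEuclideanHalfSpace]
  exact ⟨fun h => le_antisymm (not_lt.1 h) h2, fun h => not_lt.2 h.le⟩

end Charts

/-! ### From the asymptote on the manifold to coordinate data. -/

section Asymptote

variable {M : Type*} [TopologicalSpace M] [ChartedSpace (EuclideanHalfSpace 4) M]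
  {e : OpenPartialHomeomorph M (EuclideanHalfSpace 4)}
  {g q : ∀ x : M, LinearMap.BilinForm ℝ (TangentSpace (𝓡∂ 4) x)} {Ω : M → ℝ}
  {N : ∀ x : M, TangentSpace (𝓡∂ 4) x}

theorem tendsto_partialD_fderivWithin (h : HasAsymptote M g Ω q N)
    (he : e ∈ IsManifold.maximalAtlas (𝓡∂ 4) ∞ M) {p : M} (hpe : p ∈ e.source) (i : Fin 4) :
    Tendsto (partialD i (fun z => Ω ((e.extend (𝓡∂ 4)).symm z)))
      (𝓝[interior (range (𝓡∂ 4))] (e.extend (𝓡∂ 4) p))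
      (𝓝 (fderivWithin ℝ (fun z => Ω ((e.extend (𝓡∂ 4)).symm z)) (range (𝓡∂ 4))
        (e.extend (𝓡∂ 4) p) (EuclideanSpace.single i 1))) := by
  have hy₀ : e.extend (𝓡∂ 4) p ∈ (e.extend (𝓡∂ 4)).target :=
    (e.extend (𝓡∂ 4)).map_source (by rwa [e.extend_source])
  have h1 := ((contDiffWithinAt_comp_extend_symm he h.smooth_factor hy₀).fderivWithin_right
    (m := ∞) (𝓡∂ 4).uniqueDiffOn (by simp) (e.extend_target_subset_range hy₀)).clm_apply
    (contDiffWithinAt_const (c := EuclideanSpace.single i (1 : ℝ)))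
  have h2 := (h1.continuousWithinAt.mono interior_subset).tendsto
  refine h2.congr' ?_
  filter_upwards [self_mem_nhdsWithin] with y hy
  rw [partialD, fderivWithin_of_mem_nhds (mem_interior_iff_mem_nhds.1 hy)]

variable [IsManifold (𝓡∂ 4) ∞ M]

theorem extend_symm_mem_interior (he : e ∈ IsManifold.maximalAtlas (𝓡∂ 4) ∞ M)
    {y : EuclideanSpace ℝ (Fin 4)} (hy : y ∈ (e.extend (𝓡∂ 4)).target)
    (hyi : y ∈ interior (range (𝓡∂ 4))) :
    (e.extend (𝓡∂ 4)).symm y ∈ e.source ∩ (𝓡∂ 4).interior M := by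
  have h1 : (e.extend (𝓡∂ 4)).symm y ∈ e.source := by
    rw [← e.extend_source (I := 𝓡∂ 4)]; exact (e.extend (𝓡∂ 4)).map_target hy
  exact ⟨h1, (isInteriorPoint_iff_extend_mem he h1).2 (by rwa [(e.extend (𝓡∂ 4)).right_inv hy])⟩

theorem components_conformalMetric (h : HasAsymptote M g Ω q N)
    (he : e ∈ IsManifold.maximalAtlas (𝓡∂ 4) ∞ M)
    {y : EuclideanSpace ℝ (Fin 4)} (hy : y ∈ (e.extend (𝓡∂ 4)).target)
    (hyi : y ∈ interior (range (𝓡∂ 4))) :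
    components e (conformalMetric Ω g) y
      = cylinderMetric (fun z => Ω ((e.extend (𝓡∂ 4)).symm z)) (components e q) y := by
  have hx := (extend_symm_mem_interior he hy hyi).2
  have h0 := h.factor_ne_zero _ hx
  ext i j
  simp only [cylinderMetric, components, conformalMetric, Matrix.of_apply, h.q_eq _ hx,
    partialD_comp_extend_symm he h.smooth_factor hy hyi, LinearMap.smul_apply, smul_eq_mul]
  field_simp
  ring

theorem components_eq_smul_cylinderMetric (h : HasAsymptote M g Ω q N)
    (he : e ∈ IsManifold.maximalAtlas (𝓡∂ 4) ∞ M)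
    {y : EuclideanSpace ℝ (Fin 4)} (hy : y ∈ (e.extend (𝓡∂ 4)).target)
    (hyi : y ∈ interior (range (𝓡∂ 4))) :
    components e g y = (Ω ((e.extend (𝓡∂ 4)).symm y))⁻¹ ^ 2 •
      cylinderMetric (fun z => Ω ((e.extend (𝓡∂ 4)).symm z)) (components e q) y := by
  have h0 := h.factor_ne_zero _ (extend_symm_mem_interior he hy hyi).2
  rw [← components_conformalMetric h he hy hyi]
  ext i j
  simp only [components, conformalMetric, Matrix.of_apply, Matrix.smul_apply,
    LinearMap.smul_apply, smul_eq_mul]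
  field_simp

theorem components_symm (h : HasAsymptote M g Ω q N)
    (he : e ∈ IsManifold.maximalAtlas (𝓡∂ 4) ∞ M)
    {y : EuclideanSpace ℝ (Fin 4)} (hy : y ∈ (e.extend (𝓡∂ 4)).target)
    (hyi : y ∈ interior (range (𝓡∂ 4))) (i j : Fin 4) :
    components e g y i j = components e g y j i := by
  have h1 := h.vacuum.lorentzian e he _ (extend_symm_mem_interior he hy hyi)
  rw [(e.extend (𝓡∂ 4)).right_inv hy] at h1
  exact congrFun (congrFun h1.transpose_eq j) i

theorem components_q_symm (h : HasAsymptote M g Ω q N)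
    (he : e ∈ IsManifold.maximalAtlas (𝓡∂ 4) ∞ M)
    {y : EuclideanSpace ℝ (Fin 4)} (hy : y ∈ (e.extend (𝓡∂ 4)).target)
    (hyi : y ∈ interior (range (𝓡∂ 4))) (i j : Fin 4) :
    components e q y i j = components e q y j i := by
  have hx := (extend_symm_mem_interior he hy hyi).2
  have h1 := components_symm h he hy hyi i j
  simp only [components, Matrix.of_apply, h.q_eq _ hx] at h1 ⊢
  rw [h1]; ring

theorem cylinderMetric_mul_vectorComponents (h : HasAsymptote M g Ω q N)
    (he : e ∈ IsManifold.maximalAtlas (𝓡∂ 4) ∞ M)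
    {y : EuclideanSpace ℝ (Fin 4)} (hy : y ∈ (e.extend (𝓡∂ 4)).target)
    (hyi : y ∈ interior (range (𝓡∂ 4))) (i : Fin 4) :
    Ω ((e.extend (𝓡∂ 4)).symm y) ^ 2 *
      ∑ j, cylinderMetric (fun z => Ω ((e.extend (𝓡∂ 4)).symm z)) (components e q) y i j
        * vectorComponents e N y j
      = partialD i (fun z => Ω ((e.extend (𝓡∂ 4)).symm z)) y := by
  have hx := (extend_symm_mem_interior he hy hyi).2
  have h0 := h.factor_ne_zero _ hx
  have h1 := h.N_eq _ hx (coordVec e y i)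
  rw [← sum_vectorComponents_smul_coordVec he N hy, map_sum, LinearMap.sum_apply] at h1
  simp only [map_smul, LinearMap.smul_apply, smul_eq_mul] at h1
  rw [partialD_comp_extend_symm he h.smooth_factor hy hyi]
  have h2 : ∀ j, cylinderMetric (fun z => Ω ((e.extend (𝓡∂ 4)).symm z)) (components e q) y i j
      * vectorComponents e N y j = Ω ((e.extend (𝓡∂ 4)).symm y) ^ 2 *
        (vectorComponents e N y j * g _ (coordVec e y j) (coordVec e y i)) := by
    intro j
    have h3 := components_symm h he hy hyi i j
    rw [← components_conformalMetric h he hy hyi]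
    simp only [components, conformalMetric, Matrix.of_apply, LinearMap.smul_apply,
      smul_eq_mul] at h3 ⊢
    rw [h3]; ring
  simp only [h2, ← Finset.mul_sum]
  rw [h1]
  field_simp

/-- Moving in a direction tangent to the slice `y₀ = 0` stays in the boundary, where `Ω` vanishes.
-/
theorem fderivWithin_factor_succ (h : HasAsymptote M g Ω q N)
    (he : e ∈ IsManifold.maximalAtlas (𝓡∂ 4) ∞ M) {p : M} (hp : p ∈ (𝓡∂ 4).boundary M)
    (hpe : p ∈ e.source) (i : Fin 3) :
    fderivWithin ℝ (fun z => Ω ((e.extend (𝓡∂ 4)).symm z)) (range (𝓡∂ 4))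
      (e.extend (𝓡∂ 4) p) (EuclideanSpace.single i.succ 1) = 0 := by
  set y₀ := e.extend (𝓡∂ 4) p with hy₀d
  have hy₀ : y₀ ∈ (e.extend (𝓡∂ 4)).target :=
    (e.extend (𝓡∂ 4)).map_source (by rwa [e.extend_source])
  have hz : y₀ 0 = 0 := (extend_zero_of_mem_boundary he hpe).1 hp
  have h1 := ((contDiffWithinAt_comp_extend_symm he h.smooth_factor hy₀).differentiableWithinAt
    (by simp)).hasFDerivWithinAt
  let c : ℝ → EuclideanSpace ℝ (Fin 4) := fun t => y₀ + t • EuclideanSpace.single i.succ 1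
  have hc0 : c 0 = y₀ := by simp [c]
  have hcz : ∀ t, c t 0 = 0 := by
    intro t
    simp [c, hz]
  have hcr : ∀ t, c t ∈ range (𝓡∂ 4) := by
    intro t
    rw [range_modelWithCornersEuclideanHalfSpace]
    exact (hcz t).ge
  have hc : HasDerivAt c (EuclideanSpace.single i.succ 1) 0 := by
    simpa [c] using ((hasDerivAt_id (0 : ℝ)).smul_const
      (EuclideanSpace.single i.succ (1 : ℝ) : EuclideanSpace ℝ (Fin 4))).const_add y₀
  rw [← hc0] at h1
  have h2 := h1.comp_hasDerivAt 0 hc (Eventually.of_forall hcr)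
  have h3 : ((fun z => Ω ((e.extend (𝓡∂ 4)).symm z)) ∘ c) =ᶠ[𝓝 0] fun _ => 0 := by
    have h4 : Tendsto c (𝓝 0) (𝓝[range (𝓡∂ 4)] y₀) :=
      tendsto_nhdsWithin_iff.2 ⟨hc0 ▸ hc.continuousAt.tendsto, Eventually.of_forall hcr⟩
    filter_upwards [h4 (extend_target_mem_nhdsWithin_of_mem hy₀)] with t ht
    refine h.factor_eq_zero _ ((extend_zero_of_mem_boundary he ?_).2 ?_)
    · rw [← e.extend_source (I := 𝓡∂ 4)]; exact (e.extend (𝓡∂ 4)).map_target ht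
    · rw [(e.extend (𝓡∂ 4)).right_inv ht]; exact hcz t
  have h5 := (h2.congr_of_eventuallyEq h3.symm).unique (hasDerivAt_const (0 : ℝ) (0 : ℝ))
  rwa [hc0] at h5

/-- The tangential derivatives vanish, so if the normal one did too, `dΩ` would be zero at `p`. -/
theorem fderivWithin_factor_zero_ne (h : HasAsymptote M g Ω q N)
    (he : e ∈ IsManifold.maximalAtlas (𝓡∂ 4) ∞ M) {p : M} (hp : p ∈ (𝓡∂ 4).boundary M)
    (hpe : p ∈ e.source) :
    fderivWithin ℝ (fun z => Ω ((e.extend (𝓡∂ 4)).symm z)) (range (𝓡∂ 4))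
      (e.extend (𝓡∂ 4) p) (EuclideanSpace.single 0 1) ≠ 0 := by
  intro h0
  have hy₀ : e.extend (𝓡∂ 4) p ∈ (e.extend (𝓡∂ 4)).target :=
    (e.extend (𝓡∂ 4)).map_source (by rwa [e.extend_source])
  have hzero : ∀ u : EuclideanSpace ℝ (Fin 4), fderivWithin ℝ
      (fun z => Ω ((e.extend (𝓡∂ 4)).symm z)) (range (𝓡∂ 4)) (e.extend (𝓡∂ 4) p) u = 0 := by
    intro u
    have hu : u = ∑ i, u i • EuclideanSpace.single i (1 : ℝ) := by
      ext j
      simp [Pi.single_apply]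
    rw [hu, map_sum, Fin.sum_univ_succ]
    simp only [map_smul, h0, fderivWithin_factor_succ h he hp hpe, smul_zero,
      Finset.sum_const_zero, add_zero]
  have hp' : (e.extend (𝓡∂ 4)).symm (e.extend (𝓡∂ 4) p) ∈ (𝓡∂ 4).boundary M := by
    rwa [e.extend_left_inv hpe]
  obtain ⟨v, hv⟩ := h.differential_ne_zero _ hp'
  apply hv
  rw [← mfderivWithin_extend_symm_comp_mfderiv_extend he hy₀ v]
  exact (fderivWithin_comp_extend_symm he h.smooth_factor hy₀ _).symm.trans (hzero _)

theorem slicePoint_bdryCoord (he : e ∈ IsManifold.maximalAtlas (𝓡∂ 4) ∞ M) {p : M}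
    (hp : p ∈ (𝓡∂ 4).boundary M) (hpe : p ∈ e.source) :
    slicePoint (bdryCoord e p) = e.extend (𝓡∂ 4) p := by
  have hz := (extend_zero_of_mem_boundary he hpe).1 hp
  ext i
  refine Fin.cases ?_ (fun j => ?_) i
  · simpa [slicePoint] using hz.symm
  · simp [slicePoint, bdryCoord]

theorem exists_asymptoteData_of_hasAsymptote (h : HasAsymptote M g Ω q N)
    (he : e ∈ IsManifold.maximalAtlas (𝓡∂ 4) ∞ M) {p : M} (hp : p ∈ (𝓡∂ 4).boundary M)
    (hpe : p ∈ e.source) :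
    (∃ H σ, AsymptoteData (range (𝓡∂ 4)) (e.extend (𝓡∂ 4) p)
      (fun z => Ω ((e.extend (𝓡∂ 4)).symm z)) (components e q) H
      (fun y i => vectorComponents e N y i) σ) ∧
    ExtendsSmoothly (range (𝓡∂ 4)) (e.extend (𝓡∂ 4) p) fun y =>
      Ω ((e.extend (𝓡∂ 4)).symm y) ^ 2 * (cylinderMetric
        (fun z => Ω ((e.extend (𝓡∂ 4)).symm z)) (components e q) y).det := by
  have hy₀ : e.extend (𝓡∂ 4) p ∈ (e.extend (𝓡∂ 4)).target :=
    (e.extend (𝓡∂ 4)).map_source (by rwa [e.extend_source])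
  have hT := extend_target_mem_nhdsWithin_of_mem hy₀
  have hT' : ∀ᶠ y in 𝓝[interior (range (𝓡∂ 4))] (e.extend (𝓡∂ 4) p),
      y ∈ (e.extend (𝓡∂ 4)).target := nhdsWithin_mono _ interior_subset hT
  have hnear := hT'.and self_mem_nhdsWithin
  have hne : NeBot (𝓝[interior (range (𝓡∂ 4))] (e.extend (𝓡∂ 4) p)) :=
    mem_closure_iff_nhdsWithin_neBot.1
      ((𝓡∂ 4).range_subset_closure_interior (e.extend_target_subset_range hy₀))
  have hq : ∀ i j, ContDiffWithinAt ℝ ∞ (fun y => components e q y i j) (range (𝓡∂ 4))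
      (e.extend (𝓡∂ 4) p) := fun i j => (h.q_smooth e he i j _ hy₀).mono_of_mem_nhdsWithin hT
  have hN : ∀ i, ContDiffWithinAt ℝ ∞ (fun y => vectorComponents e N y i) (range (𝓡∂ 4))
      (e.extend (𝓡∂ 4) p) := fun i =>
    contDiffWithinAt_euclidean.1 ((h.N_smooth e he _ hy₀).mono_of_mem_nhdsWithin hT) i
  have hw := contDiffWithinAt_comp_extend_symm he h.smooth_factor hy₀
  have hw0 : Tendsto (fun z => Ω ((e.extend (𝓡∂ 4)).symm z))
      (𝓝[interior (range (𝓡∂ 4))] (e.extend (𝓡∂ 4) p)) (𝓝 0) := by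
    have h1 := (hw.continuousWithinAt.mono interior_subset).tendsto
    rwa [e.extend_left_inv hpe, h.factor_eq_zero p hp] at h1
  refine exists_asymptoteData (𝓡∂ 4).uniqueDiffOn (e.extend_target_subset_range hy₀)
    (.of_contDiffWithinAt hw) (fun i j => .of_contDiffWithinAt (hq i j))
    (fun i => .of_contDiffWithinAt (hN i)) hw0 ?_ ?_ ?_
    (tendsto_partialD_fderivWithin h he hpe) (fderivWithin_factor_zero_ne h he hp hpe)
    (fderivWithin_factor_succ h he hp hpe) (Q₀ := components e q (e.extend (𝓡∂ 4) p))
    (fun i j => ((hq i j).continuousWithinAt.mono interior_subset).tendsto) ?_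
  · filter_upwards [hnear] with y hy
    exact h.factor_ne_zero _ (extend_symm_mem_interior he hy.1 hy.2).2
  · filter_upwards [hnear] with y hy
    exact components_q_symm h he hy.1 hy.2
  · filter_upwards [hnear] with y hy
    exact cylinderMetric_mul_vectorComponents h he hy.1 hy.2
  · have h1 := (h.q_signature e he p ⟨hpe, hp⟩).det_ne_zero
    rwa [bdryMetric, slicePoint_bdryCoord he hp hpe] at h1

theorem ricci_cylinderMetric_eq_zero (h : HasAsymptote M g Ω q N)
    (he : e ∈ IsManifold.maximalAtlas (𝓡∂ 4) ∞ M) {p : M} (hpe : p ∈ e.source) :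
    ∀ᶠ y in 𝓝[interior (range (𝓡∂ 4))] (e.extend (𝓡∂ 4) p), ∀ d b,
      ricci (fun z => (Ω ((e.extend (𝓡∂ 4)).symm z))⁻¹ ^ 2 •
        cylinderMetric (fun z => Ω ((e.extend (𝓡∂ 4)).symm z)) (components e q) z) y d b = 0 := by
  have hT : ∀ᶠ y in 𝓝[interior (range (𝓡∂ 4))] (e.extend (𝓡∂ 4) p),
      y ∈ (e.extend (𝓡∂ 4)).target :=
    nhdsWithin_mono _ interior_subset (e.extend_target_mem_nhdsWithin (I := 𝓡∂ 4) hpe)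
  have hnear := hT.and self_mem_nhdsWithin
  filter_upwards [eventually_eventually_nhds_of_interior hnear, hnear] with y h1 h2 d b
  have h3 := h.vacuum.ricci_flat e he _ (extend_symm_mem_interior he h2.1 h2.2) d b
  rw [(e.extend (𝓡∂ 4)).right_inv h2.1] at h3
  have h4 : components e g =ᶠ[𝓝 y] fun z => (Ω ((e.extend (𝓡∂ 4)).symm z))⁻¹ ^ 2 •
      cylinderMetric (fun z => Ω ((e.extend (𝓡∂ 4)).symm z)) (components e q) z :=
    h1.mono fun z hz => components_eq_smul_cylinderMetric h he hz.1 hz.2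
  rw [← h3, ricci, ricci, riemann_congr h4]

/-- The two metrics are only known to agree on the interior, since the values of `g` on the boundary
are arbitrary. Equality of germs at interior points is what transfers curvature. -/
theorem eventually_components_conformalMetric (h : HasAsymptote M g Ω q N)
    (he : e ∈ IsManifold.maximalAtlas (𝓡∂ 4) ∞ M) {p : M} (hpe : p ∈ e.source) :
    ∀ᶠ y in 𝓝[interior (range (𝓡∂ 4))] (e.extend (𝓡∂ 4) p),
      components e (conformalMetric Ω g) =ᶠ[𝓝 y]
        cylinderMetric (fun z => Ω ((e.extend (𝓡∂ 4)).symm z)) (components e q) := by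
  have hT : ∀ᶠ y in 𝓝[interior (range (𝓡∂ 4))] (e.extend (𝓡∂ 4) p),
      y ∈ (e.extend (𝓡∂ 4)).target :=
    nhdsWithin_mono _ interior_subset (e.extend_target_mem_nhdsWithin (I := 𝓡∂ 4) hpe)
  refine (eventually_eventually_nhds_of_interior (hT.and self_mem_nhdsWithin)).mono fun y h1 =>
    h1.mono fun z hz => components_conformalMetric h he hz.1 hz.2

end Asymptote

end SpatialInfinity

end

theorem mainTheorem4 {M : Type*} [TopologicalSpace M] [ChartedSpace (EuclideanHalfSpace 4) M]
    [IsManifold (𝓡∂ 4) ∞ M]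
    (g : ∀ x : M, LinearMap.BilinForm ℝ (TangentSpace (𝓡∂ 4) x)) (Ω : M → ℝ)
    (q : ∀ x : M, LinearMap.BilinForm ℝ (TangentSpace (𝓡∂ 4) x))
    (N : ∀ x : M, TangentSpace (𝓡∂ 4) x)
    (h : SpatialInfinity.IsAMSI M g Ω q N)
    (p : M) (hp : p ∈ (𝓡∂ 4).boundary M)
    (e : OpenPartialHomeomorph M (EuclideanHalfSpace 4))
    (he : e ∈ IsManifold.maximalAtlas (𝓡∂ 4) ∞ M) (hpe : p ∈ e.source) :
    -- near `p` the level sets of `Ω` have a spacelike normal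
    (∀ᶠ x in 𝓝[(𝓡∂ 4).interior M] p,
      SpatialInfinity.covectorSq
        (SpatialInfinity.components e (SpatialInfinity.conformalMetric Ω g) (e.extend (𝓡∂ 4) x))
        (fun k => SpatialInfinity.partialD k (fun z => Ω ((e.extend (𝓡∂ 4)).symm z))
          (e.extend (𝓡∂ 4) x)) < 0) ∧
    (∀ a b : Fin 4, Filter.Tendsto
      (fun x => SpatialInfinity.electricPart
        (SpatialInfinity.components e (SpatialInfinity.conformalMetric Ω g))
        (fun z => Ω ((e.extend (𝓡∂ 4)).symm z)) (e.extend (𝓡∂ 4) x) a b)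
      (𝓝[(𝓡∂ 4).interior M] p) (𝓝 0)) ∧
    (∀ a b : Fin 4, Filter.Tendsto
      (fun x => SpatialInfinity.magneticPart
        (SpatialInfinity.components e (SpatialInfinity.conformalMetric Ω g))
        (fun z => Ω ((e.extend (𝓡∂ 4)).symm z)) (e.extend (𝓡∂ 4) x) a b)
      (𝓝[(𝓡∂ 4).interior M] p) (𝓝 0)) := by
  have hA := h.toHasAsymptote
  have hl := SpatialInfinity.tendsto_extend_interior he hpe
  have hG := SpatialInfinity.eventually_components_conformalMetric hA he hpe
  have hv := SpatialInfinity.ricci_cylinderMetric_eq_zero hA he hpe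
  obtain ⟨⟨H, σ, hD⟩, hdet⟩ := SpatialInfinity.exists_asymptoteData_of_hasAsymptote hA he hp hpe
  refine ⟨?_, fun a b => ?_, fun a b => ?_⟩
  · filter_upwards [hl.eventually hG, hl.eventually hD.covectorSq_neg] with x h1 h2
    rwa [h1.eq_of_nhds]
  · refine ((hD.tendsto_electricPart hv a b).comp hl).congr' ?_
    filter_upwards [hl.eventually hG] with x h1
    rw [Function.comp_apply, SpatialInfinity.electricPart_congr h1]
  · refine ((hD.tendsto_magneticPart hv hdet a b).comp hl).congr' ?_
    filter_upwards [hl.eventually hG] with x h1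
    rw [Function.comp_apply, SpatialInfinity.magneticPart_congr h1]
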